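/- Let $\mathbb H$ be the quaternions with basis $1,e_1,e_2,e_3=e_1e_2$, let $\mathbb S=\{I\in\mathbb H: I^2=-1\}$ and $\mathbb H^+=\{q\in\mathbb H:\mathrm{Re}\,q>0\}$. A function $f:\mathbb H^+\to\mathbb H$ is a slice function if $f(x+yJ)=\frac12\big(f(x+yI)+f(x-yI)\big)+\frac{JI}{2}\big(f(x-yI)-f(x+yI)\big)$ for all $x>0$, $y\in\mathbb R$, $I,J\in\mathbb S$; it is then of the form $f(x+yI)=\alpha(x,y)+I\beta(x,y)$ for all $I\in\mathbb S$, with $\alpha$ even and $\beta$ odd in $y$. It is slice regular if moreover, for each $I\in\mathbb S$, $(x,y)\mapsto f(x+yI)$ is $C^1$ and $(\partial_x+I\partial_y)f(x+yI)=0$. For slice functions $f=\alpha+I\beta$ and $g=\gamma+I\delta$ put $f*g=(\alpha\gamma-\beta\delta)+I(\alpha\delta+\beta\gamma)$ and $f^c=\bar\alpha+I\bar\beta$, and let $f^{-*}=(f*f^c)^{-1}f^c$ (pointwise product) where $f*f^c\neq0$. For $\theta=(\theta_1,\theta_2)\in[0,\pi]^2$ let $I(\theta)=\cos\theta_1\,e_1+\sin\theta_1\cos\theta_2\,e_2+\sin\theta_1\sin\theta_2\,e_3$.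 The slice Hardy space $H^2(\mathbb H^+)$ consists of the slice regular $f:\mathbb H^+\to\mathbb H$ with $$\sup_{x>0}\int_{[0,\pi]^2}\sin\theta_1\,d\theta\int_{-\infty}^{\infty}|f(x+I(\theta)y)|^2\,dy<\infty$$ whose boundary values $f(I(\theta)y)=\lim_{x\to0^+}f(x+I(\theta)y)$ exist for almost every $(\theta,y)$ and are square integrable for $\sin\theta_1\,d\theta\,dy$; its $\mathbb H$-valued inner product is $$\langle f,g\rangle=\frac1{2\pi}\int_{[0,\pi]^2}\sin\theta_1\,d\theta\int_{-\infty}^{\infty}\overline{g(I(\theta)y)}\,f(I(\theta)y)\,dy .$$ Let $a_1,a_2,\dots$ be any sequence in $\mathbb H^+$ (repetitions allowed). For $k\ge1$ let $$e_{a_k}(q)=\sqrt{\mathrm{Re}(a_k)/\pi}\;(q+\bar a_k)^{-*},\qquad B_k=C_1*C_2*\cdots*C_{k-1},\quad C_j(q)=(q+\bar a_j)^{-*}*(q-a_j),\qquad T_k=B_k*e_{a_k},$$ with $B_1=1$. Then $T_k\in H^2(\mathbb H^+)$ for every $k\ge1$, and $\langle T_k,T_k\rangle=1$ for all $k\ge1$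 and $\langle T_k,T_l\rangle=0$ for all $k,l\ge1$ with $k\ne l$. -/

import Mathlib

open Real Set Filter Topology MeasureTheory
open scoped Quaternion

noncomputable section

namespace SliceHardy

/-- The set `𝕊` of imaginary units of the quaternions. -/
def imagUnits : Set ℍ[ℝ] := {q | q * q = -1}

/-- The open right half space `ℍ⁺ = {q | Re q > 0}`. -/
def rightHalf : Set ℍ[ℝ] := {q | 0 < q.re}

/-- The point `x + y I` of the slice `ℂ_I`. -/
def slicePt (I : ℍ[ℝ]) (x y : ℝ) : ℍ[ℝ] := (x : ℍ[ℝ]) + (y : ℍ[ℝ]) * I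

/-- Slice functions on `Ω`. -/
def IsSlice (Ω : Set ℍ[ℝ]) (f : ℍ[ℝ] → ℍ[ℝ]) : Prop :=
  ∀ (x y : ℝ), ∀ I ∈ imagUnits, ∀ J ∈ imagUnits,
    slicePt I x y ∈ Ω → slicePt J x y ∈ Ω →
      f (slicePt J x y) =
        (1 / 2 : ℝ) • (f (slicePt I x y) + f (slicePt I x (-y))) +
        (1 / 2 : ℝ) • (J * I * (f (slicePt I x (-y)) - f (slicePt I x y)))

/-- (Left) slice regular functions on an open set `Ω`: slice functions such that, for every
imaginary unit `I`, the restriction `f_I (x + y I)` to `Ω ∩ ℂ_I` is continuously differentiable in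
the real variables `(x, y)` and satisfies `∂ₓ f_I + I ∂_y f_I = 0`. -/
structure IsSliceRegular (Ω : Set ℍ[ℝ]) (f : ℍ[ℝ] → ℍ[ℝ]) : Prop where
  slice : IsSlice Ω f
  contDiff : ∀ I ∈ imagUnits,
    ContDiffOn ℝ 1 (fun p : ℝ × ℝ => f (slicePt I p.1 p.2)) {p | slicePt I p.1 p.2 ∈ Ω}
  cauchyRiemann : ∀ I ∈ imagUnits, ∀ p : ℝ × ℝ, slicePt I p.1 p.2 ∈ Ω →
    fderiv ℝ (fun p : ℝ × ℝ => f (slicePt I p.1 p.2)) p (1, 0) +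
      I * fderiv ℝ (fun p : ℝ × ℝ => f (slicePt I p.1 p.2)) p (0, 1) = 0

/-! ### The `*`-product

A slice function is `f (x + y I) = α (x, y) + I β (x, y)` with `α` even and `β` odd in `y`. At a
point `q = x + y I` with `y > 0` one has `star q = x - y I`, hence
`α = (f q + f (star q)) / 2` and `β = -I (f q - f (star q)) / 2`; on the real axis `β = 0`. -/

/-- The imaginary unit `I` of `q = x + y I`, `y > 0`; it is `0` when `q` is real. -/
def imagDir (q : ℍ[ℝ]) : ℍ[ℝ] := (‖q.im‖⁻¹ : ℝ) • q.im

/-- The component `α` of `f = α + I β` at `q`. -/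
def alphaPart (f : ℍ[ℝ] → ℍ[ℝ]) (q : ℍ[ℝ]) : ℍ[ℝ] := (1 / 2 : ℝ) • (f q + f (star q))

/-- The component `β` of `f = α + I β` at `q`. -/
def betaPart (f : ℍ[ℝ] → ℍ[ℝ]) (q : ℍ[ℝ]) : ℍ[ℝ] :=
  -(imagDir q * ((1 / 2 : ℝ) • (f q - f (star q))))

/-- The `*`-product: `(α + I β) * (γ + I δ) = (α γ - β δ) + I (α δ + β γ)`. For convergent power
series it is `(∑ qⁿ aₙ) * (∑ qⁿ bₙ) = ∑ qⁿ ∑ₖ aₖ bₙ₋ₖ`. -/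
def starMul (f g : ℍ[ℝ] → ℍ[ℝ]) (q : ℍ[ℝ]) : ℍ[ℝ] :=
  (alphaPart f q * alphaPart g q - betaPart f q * betaPart g q) +
    imagDir q * (alphaPart f q * betaPart g q + betaPart f q * alphaPart g q)

/-- The regular conjugate `f^c = ᾱ + I β̄`; for power series, `∑ qⁿ aₙ` becomes `∑ qⁿ āₙ`. -/
def regConj (f : ℍ[ℝ] → ℍ[ℝ]) (q : ℍ[ℝ]) : ℍ[ℝ] :=
  star (alphaPart f q) + imagDir q * star (betaPart f q)

/-- The symmetrization `f^s = f * f^c`. -/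
def symmetrization (f : ℍ[ℝ] → ℍ[ℝ]) : ℍ[ℝ] → ℍ[ℝ] := starMul f (regConj f)

/-- The regular reciprocal `f^{-*} = (f^s)⁻¹ f^c`, meaningful off the zero set of `f^s`. -/
def regInv (f : ℍ[ℝ] → ℍ[ℝ]) (q : ℍ[ℝ]) : ℍ[ℝ] := (symmetrization f q)⁻¹ * regConj f q

/-- `F 1 * F 2 * ⋯ * F n` (in this order), equal to the constant `1` for `n = 0`. -/
def starProd (F : ℕ → ℍ[ℝ] → ℍ[ℝ]) : ℕ → ℍ[ℝ] → ℍ[ℝ]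
  | 0 => fun _ => 1
  | n + 1 => starMul (starProd F n) (F (n + 1))

/-! ### The slice Hardy space of the right half space -/

/-- The imaginary unit
`I(θ) = cos θ₁ e₁ + sin θ₁ cos θ₂ e₂ + sin θ₁ sin θ₂ e₃`. -/
def unitAt (θ : ℝ × ℝ) : ℍ[ℝ] :=
  ⟨0, cos θ.1, sin θ.1 * cos θ.2, sin θ.1 * sin θ.2⟩

/-- The measure `sin θ₁ dθ` on `[0, π]²`. -/
def angleMeasure : Measure (ℝ × ℝ) :=
  ((volume : Measure (ℝ × ℝ)).restrict (Icc 0 π ×ˢ Icc 0 π)).withDensity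
    (fun θ => ENNReal.ofReal (sin θ.1))

/-- The measure `sin θ₁ dθ dy` on `[0, π]² × ℝ`. -/
def boundaryMeasure : Measure ((ℝ × ℝ) × ℝ) := angleMeasure.prod (volume : Measure ℝ)

/-- The boundary value of `f` at `y I(θ)`, where `p = (θ, y)`: the limit of `f (x + y I(θ))` as
`x → 0⁺`. -/
def boundaryValue (f : ℍ[ℝ] → ℍ[ℝ]) (p : (ℝ × ℝ) × ℝ) : ℍ[ℝ] :=
  limUnder (𝓝[>] (0 : ℝ)) (fun x : ℝ => f (slicePt (unitAt p.1) x p.2))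

/-- Membership in the slice Hardy space `H²(ℍ⁺)`: `f` is slice regular on `ℍ⁺`, its square means
over the hyperplanes `Re q = x > 0` are bounded uniformly in `x`, its boundary values exist almost
everywhere, and they are square integrable. -/
structure MemHardy (f : ℍ[ℝ] → ℍ[ℝ]) : Prop where
  regular : IsSliceRegular rightHalf f
  bounded_means : ∃ C : NNReal, ∀ x : ℝ, 0 < x →
    ∫⁻ p, ‖f (slicePt (unitAt p.1) x p.2)‖ₑ ^ 2 ∂boundaryMeasure ≤ C
  boundary_limit : ∀ᵐ p ∂boundaryMeasure, ∃ w : ℍ[ℝ],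
    Tendsto (fun x : ℝ => f (slicePt (unitAt p.1) x p.2)) (𝓝[>] (0 : ℝ)) (𝓝 w)
  boundary_memLp : MemLp (boundaryValue f) 2 boundaryMeasure

/-- The quaternion-valued inner product
`⟨f, g⟩ = (1 / 2π) ∫ sin θ₁ dθ ∫ conj (g (I(θ) y)) f (I(θ) y) dy` of `H²(ℍ⁺)`. -/
def hardyInner (f g : ℍ[ℝ] → ℍ[ℝ]) : ℍ[ℝ] :=
  (1 / (2 * π) : ℝ) • ∫ p, star (boundaryValue g p) * boundaryValue f p ∂boundaryMeasure

/-! ### The Takenaka-Malmquist system -/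

/-- The normalized Szegő kernel `e_a (q) = √(Re a / π) (q + ā)^{-*}`. -/
def szego (a : ℍ[ℝ]) (q : ℍ[ℝ]) : ℍ[ℝ] := √(a.re / π) • regInv (fun s => s + star a) q

/-- The Blaschke factor `(q + ā)^{-*} * (q - a)`. -/
def blaschkeFactor (a : ℍ[ℝ]) : ℍ[ℝ] → ℍ[ℝ] :=
  starMul (regInv (fun s => s + star a)) (fun s => s - a)

/-- The Blaschke product `B_k`, the ordered `*`-product of the factors of `a_1, …, a_{k-1}`
(`k ≥ 1`, `B_1 = 1`). -/
def blaschke (a : ℕ → ℍ[ℝ]) (k : ℕ) : ℍ[ℝ] → ℍ[ℝ] :=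
  starProd (fun j => blaschkeFactor (a j)) (k - 1)

/-- `T_k = B_k * e_{a_k}` (`k ≥ 1`). -/
def tmSystem (a : ℕ → ℍ[ℝ]) (k : ℕ) : ℍ[ℝ] → ℍ[ℝ] := starMul (blaschke a k) (szego (a k))

end SliceHardy

end

/-!
A slice function `f (x + y I) = α (x, y) + I β (x, y)` is encoded by its *stem function*
`F = α + i β`, a map from `ℂ` to the complexified quaternions `ℍ ⊗ ℂ = ℍ[ℂ]`; the value at
`x + y I` is recovered by replacing `i` with `I`. The `*`-product then becomes the pointwise product
in the ring `ℍ[ℂ]`, the regular conjugate becomes `star`, and slice regularity becomes holomorphy of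
the four complex coordinates of `F` (`IsInducedBy`, `IsInducedBy.isSliceRegular`). The stem functions
of `e_a` and of the Blaschke factor `C_a` are, up to normalization,
`(z + a) / s_a(z)` and `(z + a) (z - a) / s_a(z)`, where `s_a(z) = z² + 2 Re(a) z + |a|²` has no zero
with `Re z ≥ 0`. The first is `O (1 / |z|)` and the second is bounded, which gives membership in the
Hardy space (`IsInducedBy.memHardy`).

On the boundary, `conj g · f` splits into a part that is even in `y` and independent of `I`, and an
odd part, which integrates to zero. Since `[0, π]²` carries the total mass `2π`, the inner product is
`⟨f, g⟩ = ∫ Re (G(iy)† F(iy)) dy`, where `†` is `α + i β ↦ ᾱ - i β̄` and `Re (α + i β) = α`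
(`IsInducedBy.hardyInner_eq`). On the imaginary axis `C_a† C_a = 1`, so in `⟨T_l, T_k⟩` with `k ≤ l`
the common factors `B_k` cancel. For `k = l` there remains `∫ Re (e_a† e_a)`, which is evaluated by
partial fractions. For `k < l` there remains `e_{a_k}† C_{a_k}` times a stem function that is
holomorphic and `O (1 / |z|)`. Because `e_a† C_a = -e_a` on the axis
(`adj_kernelStem_mul_factorStem`), the integrand extends holomorphically to the closed right half
plane with decay `O (1 / |z|²)`, and Cauchy's theorem (`IsHolomorphic.integral_rePart_eq_zero`)
gives `0`.
-/

open scoped ComplexConjugate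

noncomputable section

namespace SliceHardy

/-! ### Complexified quaternions and stem functions -/

/-- The `ℝ`-linear map `ℂ → ℍ`, `u + i v ↦ u + v I`. It is an embedding of fields when `I ^ 2 = -1`;
for `I = 0` it takes the real part. -/
def unitMap (I : ℍ[ℝ]) : ℂ →L[ℝ] ℍ[ℝ] :=
  Complex.reCLM.smulRight (1 : ℍ[ℝ]) + Complex.imCLM.smulRight I

/-- The unit `e₁`. -/
def e₁ : ℍ[ℝ] := ⟨0, 1, 0, 0⟩

/-- The unit `e₂`. -/
def e₂ : ℍ[ℝ] := ⟨0, 0, 1, 0⟩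

/-- The unit `e₃`. -/
def e₃ : ℍ[ℝ] := ⟨0, 0, 0, 1⟩

/-- The value `α + I β` of the complexified quaternion `α + i β`, written through the coordinates
of `α + i β` with respect to `1, e₁, e₂, e₃`. -/
def sliceEval (I : ℍ[ℝ]) (w : ℍ[ℂ]) : ℍ[ℝ] :=
  unitMap I w.re + unitMap I w.imI * e₁ + unitMap I w.imJ * e₂ +
    unitMap I w.imK * e₃

/-- The component `α` of the complexified quaternion `α + i β`. -/
def rePart (w : ℍ[ℂ]) : ℍ[ℝ] := ⟨w.re.re, w.imI.re, w.imJ.re, w.imK.re⟩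

/-- The component `β` of the complexified quaternion `α + i β`. -/
def imPart (w : ℍ[ℂ]) : ℍ[ℝ] := ⟨w.re.im, w.imI.im, w.imJ.im, w.imK.im⟩

/-- The inclusion `ℍ → ℍ ⊗ ℂ`. -/
def complexify (q : ℍ[ℝ]) : ℍ[ℂ] := ⟨q.re, q.imI, q.imJ, q.imK⟩

/-- The conjugation `α + i β ↦ α - i β`, a ring automorphism. -/
def coeffConj (w : ℍ[ℂ]) : ℍ[ℂ] := ⟨conj w.re, conj w.imI, conj w.imJ, conj w.imK⟩

/-- The conjugation `α + i β ↦ ᾱ - i β̄`, a ring antiautomorphism. -/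
def adj (w : ℍ[ℂ]) : ℍ[ℂ] := star (coeffConj w)

@[simp] lemma re_e₁ : e₁.re = 0 := rfl
@[simp] lemma imI_e₁ : e₁.imI = 1 := rfl
@[simp] lemma imJ_e₁ : e₁.imJ = 0 := rfl
@[simp] lemma imK_e₁ : e₁.imK = 0 := rfl

@[simp] lemma re_e₂ : e₂.re = 0 := rfl
@[simp] lemma imI_e₂ : e₂.imI = 0 := rfl
@[simp] lemma imJ_e₂ : e₂.imJ = 1 := rfl
@[simp] lemma imK_e₂ : e₂.imK = 0 := rfl

@[simp] lemma re_e₃ : e₃.re = 0 := rfl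
@[simp] lemma imI_e₃ : e₃.imI = 0 := rfl
@[simp] lemma imJ_e₃ : e₃.imJ = 0 := rfl
@[simp] lemma imK_e₃ : e₃.imK = 1 := rfl

@[simp] lemma re_rePart (w : ℍ[ℂ]) : (rePart w).re = w.re.re := rfl
@[simp] lemma imI_rePart (w : ℍ[ℂ]) : (rePart w).imI = w.imI.re := rfl
@[simp] lemma imJ_rePart (w : ℍ[ℂ]) : (rePart w).imJ = w.imJ.re := rfl
@[simp] lemma imK_rePart (w : ℍ[ℂ]) : (rePart w).imK = w.imK.re := rfl

@[simp] lemma re_imPart (w : ℍ[ℂ]) : (imPart w).re = w.re.im := rfl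
@[simp] lemma imI_imPart (w : ℍ[ℂ]) : (imPart w).imI = w.imI.im := rfl
@[simp] lemma imJ_imPart (w : ℍ[ℂ]) : (imPart w).imJ = w.imJ.im := rfl
@[simp] lemma imK_imPart (w : ℍ[ℂ]) : (imPart w).imK = w.imK.im := rfl

@[simp] lemma re_complexify (w : ℍ[ℝ]) : (complexify w).re = w.re := rfl
@[simp] lemma imI_complexify (w : ℍ[ℝ]) : (complexify w).imI = w.imI := rfl
@[simp] lemma imJ_complexify (w : ℍ[ℝ]) : (complexify w).imJ = w.imJ := rfl
@[simp] lemma imK_complexify (w : ℍ[ℝ]) : (complexify w).imK = w.imK := rfl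

@[simp] lemma re_coeffConj (w : ℍ[ℂ]) : (coeffConj w).re = conj w.re := rfl
@[simp] lemma imI_coeffConj (w : ℍ[ℂ]) : (coeffConj w).imI = conj w.imI := rfl
@[simp] lemma imJ_coeffConj (w : ℍ[ℂ]) : (coeffConj w).imJ = conj w.imJ := rfl
@[simp] lemma imK_coeffConj (w : ℍ[ℂ]) : (coeffConj w).imK = conj w.imK := rfl

lemma unitMap_apply (I : ℍ[ℝ]) (c : ℂ) : unitMap I c = (c.re : ℍ[ℝ]) + (c.im : ℍ[ℝ]) * I := by
  ext <;> simp [unitMap]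

lemma sliceEval_eq (I : ℍ[ℝ]) (w : ℍ[ℂ]) : sliceEval I w = rePart w + I * imPart w := by
  ext <;> simp [sliceEval, unitMap_apply] <;> ring

lemma sliceEval_zero (w : ℍ[ℂ]) : sliceEval 0 w = rePart w := by
  simp [sliceEval_eq]

lemma rePart_mul (v w : ℍ[ℂ]) :
    rePart (v * w) = rePart v * rePart w - imPart v * imPart w := by
  ext <;> simp <;> ring

lemma imPart_mul (v w : ℍ[ℂ]) :
    imPart (v * w) = rePart v * imPart w + imPart v * rePart w := by
  ext <;> simp <;> ring

lemma rePart_star (w : ℍ[ℂ]) : rePart (star w) = star (rePart w) := by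
  ext <;> simp

lemma imPart_star (w : ℍ[ℂ]) : imPart (star w) = star (imPart w) := by
  ext <;> simp

lemma rePart_coeffConj (w : ℍ[ℂ]) : rePart (coeffConj w) = rePart w := by
  ext <;> simp

lemma imPart_coeffConj (w : ℍ[ℂ]) : imPart (coeffConj w) = -imPart w := by
  ext <;> simp

lemma coeffConj_mul (v w : ℍ[ℂ]) : coeffConj (v * w) = coeffConj v * coeffConj w := by
  ext : 1 <;> simp

lemma coeffConj_add (v w : ℍ[ℂ]) : coeffConj (v + w) = coeffConj v + coeffConj w := by
  ext : 1 <;> simp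

lemma coeffConj_sub (v w : ℍ[ℂ]) : coeffConj (v - w) = coeffConj v - coeffConj w := by
  ext : 1 <;> simp

lemma coeffConj_star (w : ℍ[ℂ]) : coeffConj (star w) = star (coeffConj w) := by
  ext : 1 <;> simp

lemma coeffConj_smul (c : ℂ) (w : ℍ[ℂ]) : coeffConj (c • w) = conj c • coeffConj w := by
  ext : 1 <;> simp

lemma coeffConj_one : coeffConj 1 = 1 := by
  ext : 1 <;> simp

lemma coeffConj_complexify (q : ℍ[ℝ]) : coeffConj (complexify q) = complexify q := by
  ext : 1 <;> simp

lemma coeffConj_coe (c : ℂ) : coeffConj (c : ℍ[ℂ]) = ((conj c : ℂ) : ℍ[ℂ]) := by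
  ext : 1 <;> simp

lemma adj_mul (v w : ℍ[ℂ]) : adj (v * w) = adj w * adj v := by
  simp [adj, coeffConj_mul]

lemma rePart_adj_mul (v w : ℍ[ℂ]) :
    rePart (adj v * w) = star (rePart v) * rePart w + star (imPart v) * imPart w := by
  simp [adj, rePart_mul, rePart_star, imPart_star, rePart_coeffConj, imPart_coeffConj]

lemma imagUnits_re {I : ℍ[ℝ]} (hI : I ∈ imagUnits) : I.re = 0 := by
  have h : I * I = -1 := hI
  rw [Quaternion.ext_iff] at h
  simp at h
  obtain ⟨h0, h1, h2, h3⟩ := h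
  by_contra hne
  have e1 : I.imI = 0 := by
    have : 2 * I.re * I.imI = 0 := by linarith
    simpa [hne] using this
  have e2 : I.imJ = 0 := by
    have : 2 * I.re * I.imJ = 0 := by linarith
    simpa [hne] using this
  have e3 : I.imK = 0 := by
    have : 2 * I.re * I.imK = 0 := by linarith
    simpa [hne] using this
  rw [e1, e2, e3] at h0
  nlinarith [mul_self_nonneg I.re]

lemma star_imagUnits {I : ℍ[ℝ]} (hI : I ∈ imagUnits) : star I = -I := by
  have := imagUnits_re hI
  ext <;> simp [this]

lemma norm_imagUnits {I : ℍ[ℝ]} (hI : I ∈ imagUnits) : ‖I‖ = 1 := by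
  have h : I * I = -1 := hI
  have : ‖I‖ * ‖I‖ = 1 := by rw [← norm_mul, h]; simp
  nlinarith [norm_nonneg I]

lemma star_mul_self_imagUnits {I : ℍ[ℝ]} (hI : I ∈ imagUnits) : star I * I = 1 := by
  have h : I * I = -1 := hI
  rw [star_imagUnits hI, neg_mul, h, neg_neg]

@[simp] lemma re_unitAt (θ : ℝ × ℝ) : (unitAt θ).re = 0 := rfl
@[simp] lemma imI_unitAt (θ : ℝ × ℝ) : (unitAt θ).imI = cos θ.1 := rfl
@[simp] lemma imJ_unitAt (θ : ℝ × ℝ) : (unitAt θ).imJ = sin θ.1 * cos θ.2 := rfl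
@[simp] lemma imK_unitAt (θ : ℝ × ℝ) : (unitAt θ).imK = sin θ.1 * sin θ.2 := rfl

lemma unitAt_mem_imagUnits (θ : ℝ × ℝ) : unitAt θ ∈ imagUnits := by
  have h1 := sin_sq_add_cos_sq θ.1
  have h2 := sin_sq_add_cos_sq θ.2
  change unitAt θ * unitAt θ = -1
  ext <;> simp
  · linear_combination -h1 - sin θ.1 ^ 2 * h2
  all_goals ring

lemma unitMap_mul {I : ℍ[ℝ]} (hI : I ∈ imagUnits) (c d : ℂ) :
    unitMap I (c * d) = unitMap I c * unitMap I d := by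
  have h : I * I = -1 := hI
  have key : unitMap I c * unitMap I d =
      ((c.re * d.re : ℝ) : ℍ[ℝ]) + ((c.re * d.im + c.im * d.re : ℝ) : ℍ[ℝ]) * I +
        ((c.im * d.im : ℝ) : ℍ[ℝ]) * (I * I) := by
    rw [unitMap_apply, unitMap_apply]
    ext <;> simp <;> ring
  rw [key, h, unitMap_apply]
  ext <;> simp
  ring

lemma unitMap_I_mul {I : ℍ[ℝ]} (hI : I ∈ imagUnits) (c : ℂ) :
    unitMap I (Complex.I * c) = I * unitMap I c := by
  rw [unitMap_mul hI]
  simp [unitMap_apply]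

lemma unitMap_inv {I : ℍ[ℝ]} (hI : I ∈ imagUnits) (c : ℂ) :
    unitMap I c⁻¹ = (unitMap I c)⁻¹ := by
  rcases eq_or_ne c 0 with rfl | hc
  · simp
  · refine eq_inv_of_mul_eq_one_left ?_
    rw [← unitMap_mul hI, inv_mul_cancel₀ hc]
    simp [unitMap_apply]

lemma sliceEval_smul {I : ℍ[ℝ]} (hI : I ∈ imagUnits) (c : ℂ) (w : ℍ[ℂ]) :
    sliceEval I (c • w) = unitMap I c * sliceEval I w := by
  simp only [sliceEval, Quaternion.re_smul, Quaternion.imI_smul, Quaternion.imJ_smul,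
    Quaternion.imK_smul, smul_eq_mul, unitMap_mul hI, mul_add, mul_assoc]

lemma norm_unitMap_le {I : ℍ[ℝ]} (hI : ‖I‖ ≤ 1) (c : ℂ) : ‖unitMap I c‖ ≤ 2 * ‖c‖ := by
  rw [unitMap_apply]
  have h1 := Complex.abs_re_le_norm c
  have h2 := Complex.abs_im_le_norm c
  refine (norm_add_le _ _).trans ?_
  rw [norm_mul, Quaternion.norm_coe, Quaternion.norm_coe, Real.norm_eq_abs, Real.norm_eq_abs]
  nlinarith [abs_nonneg c.im]

/-- The slice function `f` is induced by the stem function `F`: `f (x + y I)` arises from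
`F (x + i y)` by replacing `i` with `I`, and `F (conj z)` is the conjugate of `F z`, which makes
`α` even and `β` odd in `y`. -/
structure IsInducedBy (f : ℍ[ℝ] → ℍ[ℝ]) (F : ℂ → ℍ[ℂ]) : Prop where
  symm : ∀ z, F (conj z) = coeffConj (F z)
  eval : ∀ I ∈ imagUnits, ∀ x y : ℝ, f (slicePt I x y) = sliceEval I (F ⟨x, y⟩)

lemma star_slicePt {I : ℍ[ℝ]} (hI : I ∈ imagUnits) (x y : ℝ) :
    star (slicePt I x y) = slicePt I x (-y) := by
  have := imagUnits_re hI
  ext <;> simp [slicePt, this, mul_comm]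

lemma slicePt_re {I : ℍ[ℝ]} (hI : I ∈ imagUnits) (x y : ℝ) : (slicePt I x y).re = x := by
  have := imagUnits_re hI
  simp [slicePt, this]

/-- `imagDir (x + y I)` is the sign of `y` times `I`. -/
lemma imagDir_slicePt {I : ℍ[ℝ]} (hI : I ∈ imagUnits) (x y : ℝ) :
    imagDir (slicePt I x y) = (|y|⁻¹ * y) • I := by
  have h0 := imagUnits_re hI
  have him : (slicePt I x y).im = y • I := by
    ext <;> simp [slicePt, h0]
  rw [imagDir, him, norm_smul, norm_imagUnits hI, mul_one, Real.norm_eq_abs, smul_smul]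

namespace IsInducedBy

variable {f g : ℍ[ℝ] → ℍ[ℝ]} {F G : ℂ → ℍ[ℂ]}

lemma eval_neg (hf : IsInducedBy f F) {I : ℍ[ℝ]} (hI : I ∈ imagUnits) (x y : ℝ) :
    f (slicePt I x (-y)) = rePart (F ⟨x, y⟩) - I * imPart (F ⟨x, y⟩) := by
  have : (⟨x, -y⟩ : ℂ) = conj (⟨x, y⟩ : ℂ) := by
    apply Complex.ext <;> simp
  rw [hf.eval I hI, this, hf.symm, sliceEval_eq, rePart_coeffConj, imPart_coeffConj, mul_neg,
    sub_eq_add_neg]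

lemma eval_eq (hf : IsInducedBy f F) {I : ℍ[ℝ]} (hI : I ∈ imagUnits) (x y : ℝ) :
    f (slicePt I x y) = rePart (F ⟨x, y⟩) + I * imPart (F ⟨x, y⟩) := by
  rw [hf.eval I hI, sliceEval_eq]

lemma imPart_real (hf : IsInducedBy f F) (x : ℝ) : imPart (F ⟨x, 0⟩) = 0 := by
  have h := hf.symm ⟨x, 0⟩
  have hx : conj (⟨x, 0⟩ : ℂ) = ⟨x, 0⟩ := by apply Complex.ext <;> simp
  rw [hx] at h
  have h' := congrArg imPart h
  rw [imPart_coeffConj] at h'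
  rw [Quaternion.ext_iff] at h' ⊢
  simpa [self_eq_neg] using h'

lemma alphaPart_slicePt (hf : IsInducedBy f F) {I : ℍ[ℝ]} (hI : I ∈ imagUnits) (x y : ℝ) :
    alphaPart f (slicePt I x y) = rePart (F ⟨x, y⟩) := by
  rw [alphaPart, star_slicePt hI, hf.eval_neg hI, hf.eval_eq hI]
  module

lemma betaPart_slicePt (hf : IsInducedBy f F) {I : ℍ[ℝ]} (hI : I ∈ imagUnits) (x y : ℝ) :
    betaPart f (slicePt I x y) = (|y|⁻¹ * y) • imPart (F ⟨x, y⟩) := by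
  have h : I * I = -1 := hI
  rw [betaPart, star_slicePt hI, hf.eval_neg hI, hf.eval_eq hI, imagDir_slicePt hI]
  have : (1 / 2 : ℝ) • (rePart (F ⟨x, y⟩) + I * imPart (F ⟨x, y⟩) -
      (rePart (F ⟨x, y⟩) - I * imPart (F ⟨x, y⟩))) = I * imPart (F ⟨x, y⟩) := by module
  rw [this, smul_mul_assoc, ← mul_assoc, h]
  simp

lemma starMul (hf : IsInducedBy f F) (hg : IsInducedBy g G) :
    IsInducedBy (SliceHardy.starMul f g) (fun z => F z * G z) where
  symm z := by rw [hf.symm, hg.symm, coeffConj_mul]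
  eval I hI x y := by
    rw [SliceHardy.starMul, hf.alphaPart_slicePt hI, hg.alphaPart_slicePt hI,
      hf.betaPart_slicePt hI, hg.betaPart_slicePt hI, imagDir_slicePt hI, sliceEval_eq,
      rePart_mul, imPart_mul]
    -- On the real axis `imagDir` is the junk value `0`, but there `β = 0`.
    rcases eq_or_ne y 0 with rfl | hy
    · simp [hf.imPart_real, hg.imPart_real]
    · -- `imagDir` and `betaPart` carry the same sign `±1`, which cancels in their product.
      have hs : (|y|⁻¹ * y) * (|y|⁻¹ * y) = 1 := by
        have := abs_ne_zero.mpr hy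
        field_simp
        simp
      simp only [smul_mul_assoc, mul_smul_comm, ← smul_add, smul_smul, hs, one_smul]

lemma regConj (hf : IsInducedBy f F) :
    IsInducedBy (SliceHardy.regConj f) (fun z => star (F z)) where
  symm z := by rw [hf.symm, coeffConj_star]
  eval I hI x y := by
    rw [SliceHardy.regConj, hf.alphaPart_slicePt hI, hf.betaPart_slicePt hI, imagDir_slicePt hI,
      sliceEval_eq, rePart_star, imPart_star]
    rcases eq_or_ne y 0 with rfl | hy
    · simp [hf.imPart_real]
    · have hs : (|y|⁻¹ * y) * (|y|⁻¹ * y) = 1 := by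
        have := abs_ne_zero.mpr hy
        field_simp
        simp
      rw [Quaternion.star_smul, mul_smul_comm, smul_mul_assoc, smul_smul, hs, one_smul]

/-- If the symmetrization of `f` is induced by the complex-valued function `n`, the regular
reciprocal of `f` is induced by `n⁻¹ F^c`; at a zero of `n` both sides are `0`. -/
lemma regInv (hf : IsInducedBy f F) {n : ℂ → ℂ} (hn : ∀ z, F z * star (F z) = (n z : ℍ[ℂ])) :
    IsInducedBy (SliceHardy.regInv f) (fun z => (n z)⁻¹ • star (F z)) where
  symm z := by
    have h : ((n (conj z) : ℂ) : ℍ[ℂ]) = ((conj (n z) : ℂ) : ℍ[ℂ]) := by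
      rw [← hn, hf.symm, ← coeffConj_coe, ← hn, coeffConj_mul, coeffConj_star]
    rw [hf.symm, coeffConj_smul, coeffConj_star, Quaternion.coe_injective h, map_inv₀]
  eval I hI x y := by
    have h := (hf.starMul hf.regConj).eval I hI x y
    have h' : sliceEval I ((n ⟨x, y⟩ : ℂ) : ℍ[ℂ]) = unitMap I (n ⟨x, y⟩) := by
      simp [sliceEval]
    simp only [hn, h'] at h
    rw [SliceHardy.regInv, symmetrization, h, hf.regConj.eval I hI, sliceEval_smul hI,
      unitMap_inv hI]

lemma real_smul (hf : IsInducedBy f F) (r : ℝ) :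
    IsInducedBy (fun q => r • f q) (fun z => (r : ℂ) • F z) where
  symm z := by rw [hf.symm, coeffConj_smul, Complex.conj_ofReal]
  eval I hI x y := by
    rw [hf.eval I hI, sliceEval_smul hI]
    simp [unitMap_apply, Quaternion.coe_mul_eq_smul]

end IsInducedBy

lemma isInducedBy_one : IsInducedBy (fun _ => 1) (fun _ => 1) where
  symm _ := coeffConj_one.symm
  eval I _ x y := by simp [sliceEval, unitMap_apply]

lemma isInducedBy_add_const (b : ℍ[ℝ]) :
    IsInducedBy (fun q => q + b) (fun z => (z : ℍ[ℂ]) + complexify b) where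
  symm z := by rw [coeffConj_add, coeffConj_coe, coeffConj_complexify]
  eval I _ x y := by
    rw [sliceEval_eq]
    ext <;> simp [slicePt] <;> ring

lemma isInducedBy_sub_const (b : ℍ[ℝ]) :
    IsInducedBy (fun q => q - b) (fun z => (z : ℍ[ℂ]) - complexify b) where
  symm z := by rw [coeffConj_sub, coeffConj_coe, coeffConj_complexify]
  eval I _ x y := by
    rw [sliceEval_eq]
    ext <;> simp [slicePt] <;> ring

/-! ### Holomorphic stem functions and their growth -/

/-- The sum of the absolute values of the four coordinates, a submultiplicative norm. -/
def coordNorm (w : ℍ[ℂ]) : ℝ := ‖w.re‖ + ‖w.imI‖ + ‖w.imJ‖ + ‖w.imK‖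

lemma coordNorm_nonneg (w : ℍ[ℂ]) : 0 ≤ coordNorm w := by
  unfold coordNorm; positivity

lemma norm_re_le_coordNorm (w : ℍ[ℂ]) : ‖w.re‖ ≤ coordNorm w := by
  unfold coordNorm; linarith [norm_nonneg w.imI, norm_nonneg w.imJ, norm_nonneg w.imK]

lemma norm_imI_le_coordNorm (w : ℍ[ℂ]) : ‖w.imI‖ ≤ coordNorm w := by
  unfold coordNorm; linarith [norm_nonneg w.re, norm_nonneg w.imJ, norm_nonneg w.imK]

lemma norm_imJ_le_coordNorm (w : ℍ[ℂ]) : ‖w.imJ‖ ≤ coordNorm w := by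
  unfold coordNorm; linarith [norm_nonneg w.imI, norm_nonneg w.re, norm_nonneg w.imK]

lemma norm_imK_le_coordNorm (w : ℍ[ℂ]) : ‖w.imK‖ ≤ coordNorm w := by
  unfold coordNorm; linarith [norm_nonneg w.imI, norm_nonneg w.imJ, norm_nonneg w.re]

lemma coordNorm_add_le (v w : ℍ[ℂ]) : coordNorm (v + w) ≤ coordNorm v + coordNorm w := by
  simp only [coordNorm, Quaternion.re_add, Quaternion.imI_add, Quaternion.imJ_add,
    Quaternion.imK_add]
  linarith [norm_add_le v.re w.re, norm_add_le v.imI w.imI, norm_add_le v.imJ w.imJ,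
    norm_add_le v.imK w.imK]

lemma coordNorm_smul (c : ℂ) (w : ℍ[ℂ]) : coordNorm (c • w) = ‖c‖ * coordNorm w := by
  simp [coordNorm, mul_add]

lemma coordNorm_coe (c : ℂ) : coordNorm (c : ℍ[ℂ]) = ‖c‖ := by
  simp [coordNorm]

lemma coordNorm_mul_le (v w : ℍ[ℂ]) : coordNorm (v * w) ≤ coordNorm v * coordNorm w := by
  have h4 (a b c d : ℂ) : ‖a + b + c + d‖ ≤ ‖a‖ + ‖b‖ + ‖c‖ + ‖d‖ :=
    norm_add₄_le
  have h1 := h4 (v.re * w.re) (-(v.imI * w.imI)) (-(v.imJ * w.imJ)) (-(v.imK * w.imK))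
  have h2 := h4 (v.re * w.imI) (v.imI * w.re) (v.imJ * w.imK) (-(v.imK * w.imJ))
  have h3 := h4 (v.re * w.imJ) (-(v.imI * w.imK)) (v.imJ * w.re) (v.imK * w.imI)
  have h5 := h4 (v.re * w.imK) (v.imI * w.imJ) (-(v.imJ * w.imI)) (v.imK * w.re)
  simp only [norm_neg, norm_mul, ← sub_eq_add_neg] at h1 h2 h3 h5
  simp only [coordNorm, Quaternion.re_mul, Quaternion.imI_mul, Quaternion.imJ_mul,
    Quaternion.imK_mul]
  linarith

lemma norm_sliceEval_le {I : ℍ[ℝ]} (hI : ‖I‖ ≤ 1) (w : ℍ[ℂ]) :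
    ‖sliceEval I w‖ ≤ 2 * coordNorm w := by
  have h1 : ‖e₁‖ = 1 := norm_imagUnits (by change e₁ * e₁ = -1; ext <;> simp)
  have h2 : ‖e₂‖ = 1 := norm_imagUnits (by change e₂ * e₂ = -1; ext <;> simp)
  have h3 : ‖e₃‖ = 1 := norm_imagUnits (by change e₃ * e₃ = -1; ext <;> simp)
  refine norm_add₄_le.trans ?_
  simp only [norm_mul, h1, h2, h3, mul_one, coordNorm]
  linarith [norm_unitMap_le hI w.re, norm_unitMap_le hI w.imI, norm_unitMap_le hI w.imJ,
    norm_unitMap_le hI w.imK]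

/-- The coordinates of `F` are holomorphic at every point of the closed right half plane. -/
structure IsHolomorphic (F : ℂ → ℍ[ℂ]) : Prop where
  re : ∀ z : ℂ, 0 ≤ z.re → DifferentiableAt ℂ (fun z => (F z).re) z
  imI : ∀ z : ℂ, 0 ≤ z.re → DifferentiableAt ℂ (fun z => (F z).imI) z
  imJ : ∀ z : ℂ, 0 ≤ z.re → DifferentiableAt ℂ (fun z => (F z).imJ) z
  imK : ∀ z : ℂ, 0 ≤ z.re → DifferentiableAt ℂ (fun z => (F z).imK) z

namespace IsHolomorphic

variable {F G : ℂ → ℍ[ℂ]}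

lemma mul (hF : IsHolomorphic F) (hG : IsHolomorphic G) :
    IsHolomorphic (fun z => F z * G z) := by
  constructor <;> intro z hz <;>
  · have f0 := hF.re z hz
    have f1 := hF.imI z hz
    have f2 := hF.imJ z hz
    have f3 := hF.imK z hz
    have g0 := hG.re z hz
    have g1 := hG.imI z hz
    have g2 := hG.imJ z hz
    have g3 := hG.imK z hz
    simp only [Quaternion.re_mul, Quaternion.imI_mul, Quaternion.imJ_mul, Quaternion.imK_mul]
    fun_prop

lemma smul (hF : IsHolomorphic F) {c : ℂ → ℂ}
    (hc : ∀ z : ℂ, 0 ≤ z.re → DifferentiableAt ℂ c z) : IsHolomorphic (fun z => c z • F z) where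
  re z hz := (hc z hz).mul (hF.re z hz)
  imI z hz := (hc z hz).mul (hF.imI z hz)
  imJ z hz := (hc z hz).mul (hF.imJ z hz)
  imK z hz := (hc z hz).mul (hF.imK z hz)

lemma const (w : ℍ[ℂ]) : IsHolomorphic (fun _ => w) := by
  constructor <;> intro z _ <;> fun_prop

lemma coe_add (w : ℍ[ℂ]) : IsHolomorphic (fun z => (z : ℍ[ℂ]) + w) := by
  constructor <;> intro z _ <;> simp

lemma coe_sub (w : ℍ[ℂ]) : IsHolomorphic (fun z => (z : ℍ[ℂ]) - w) := by
  constructor <;> intro z _ <;> simp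

end IsHolomorphic

/-- `F` is dominated by `φ` on the closed right half plane. -/
def IsDominatedBy (F : ℂ → ℍ[ℂ]) (φ : ℂ → ℝ) : Prop :=
  ∃ K : ℝ, ∀ z : ℂ, 0 ≤ z.re → coordNorm (F z) ≤ K * φ z

lemma IsDominatedBy.mul {F G : ℂ → ℍ[ℂ]} {φ ψ : ℂ → ℝ} (hF : IsDominatedBy F φ)
    (hG : IsDominatedBy G ψ) : IsDominatedBy (fun z => F z * G z) (fun z => φ z * ψ z) := by
  obtain ⟨K, hK⟩ := hF
  obtain ⟨M, hM⟩ := hG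
  refine ⟨K * M, fun z hz => (coordNorm_mul_le _ _).trans ?_⟩
  calc coordNorm (F z) * coordNorm (G z) ≤ (K * φ z) * (M * ψ z) :=
        mul_le_mul (hK z hz) (hM z hz) (coordNorm_nonneg _)
          ((coordNorm_nonneg _).trans (hK z hz))
    _ = K * M * (φ z * ψ z) := by ring

lemma one_le_norm_add_one {z : ℂ} (hz : 0 ≤ z.re) : 1 ≤ ‖z + 1‖ := by
  have h := Complex.re_le_norm (z + 1)
  simp at h
  linarith

lemma sq_norm_add_one (x y : ℝ) : ‖(⟨x, y⟩ : ℂ) + 1‖ ^ 2 = (x + 1) ^ 2 + y ^ 2 := by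
  rw [Complex.sq_norm, Complex.normSq_apply]
  simp
  ring

lemma inv_norm_add_one_sq_le {x : ℝ} (hx : 0 ≤ x) (y : ℝ) :
    ‖(⟨x, y⟩ : ℂ) + 1‖⁻¹ * ‖(⟨x, y⟩ : ℂ) + 1‖⁻¹ ≤ (1 + y ^ 2)⁻¹ := by
  rw [← mul_inv, ← sq, sq_norm_add_one]
  apply inv_anti₀ (by positivity)
  nlinarith

/-! ### Regularity of the slice function of a holomorphic stem function -/

lemma continuous_mk_zero : Continuous (fun y : ℝ => (⟨0, y⟩ : ℂ)) := by
  simp only [Complex.mk_eq_add_mul_I]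
  fun_prop

/-- The chain rule for `(x, y) ↦ c (x + y I)`, with the Cauchy-Riemann equation of the holomorphic
function `c` carried over to `ℂ_I`. -/
lemma exists_hasFDerivAt_unitMap {I : ℍ[ℝ]} (hI : I ∈ imagUnits) {c : ℂ → ℂ} {p : ℝ × ℝ}
    (hc : DifferentiableAt ℂ c ⟨p.1, p.2⟩) :
    ∃ L : ℝ × ℝ →L[ℝ] ℍ[ℝ], HasFDerivAt (fun p : ℝ × ℝ => unitMap I (c ⟨p.1, p.2⟩)) L p ∧
      L (1, 0) + I * L (0, 1) = 0 := by
  have h1 : HasFDerivAt c ((fderiv ℂ c ⟨p.1, p.2⟩).restrictScalars ℝ)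
      (Complex.equivRealProdCLM.symm p) := hc.hasFDerivAt.restrictScalars ℝ
  have h2 := h1.comp p Complex.equivRealProdCLM.symm.hasFDerivAt
  have h3 := (unitMap I).hasFDerivAt.comp p h2
  refine ⟨_, h3, ?_⟩
  have e1 : Complex.equivRealProdCLM.symm ((1 : ℝ), (0 : ℝ)) = 1 := by
    apply Complex.ext <;> simp
  have e2 : Complex.equivRealProdCLM.symm ((0 : ℝ), (1 : ℝ)) = Complex.I * 1 := by
    apply Complex.ext <;> simp
  have h : I * I = -1 := hI
  simp only [ContinuousLinearMap.comp_apply, ContinuousLinearEquiv.coe_coe,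
    ContinuousLinearMap.coe_restrictScalars', e1, e2]
  have e3 : fderiv ℂ c ⟨p.1, p.2⟩ (Complex.I * 1) = Complex.I * fderiv ℂ c ⟨p.1, p.2⟩ 1 := by
    rw [← smul_eq_mul, map_smul, smul_eq_mul]
  rw [e3, unitMap_I_mul hI, ← mul_assoc, h]
  simp

lemma contDiffOn_unitMap {I : ℍ[ℝ]} {c : ℂ → ℂ}
    (hc : ∀ z : ℂ, 0 ≤ z.re → DifferentiableAt ℂ c z) :
    ContDiffOn ℝ 1 (fun p : ℝ × ℝ => unitMap I (c ⟨p.1, p.2⟩)) {p | 0 < p.1} := by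
  have hopen : IsOpen {z : ℂ | 0 < z.re} := isOpen_lt continuous_const Complex.continuous_re
  have h1 : ContDiffOn ℂ 1 c {z : ℂ | 0 < z.re} :=
    DifferentiableOn.contDiffOn
      (fun z hz => (hc z (le_of_lt hz)).differentiableWithinAt) hopen
  have h2 : ContDiffOn ℝ 1 (c ∘ Complex.equivRealProdCLM.symm) {p : ℝ × ℝ | 0 < p.1} :=
    (h1.restrict_scalars ℝ).comp Complex.equivRealProdCLM.symm.contDiff.contDiffOn
      (fun p hp => by simpa using hp)
  exact (unitMap I).contDiff.comp_contDiffOn h2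

lemma IsInducedBy.isSliceRegular {f : ℍ[ℝ] → ℍ[ℝ]} {F : ℂ → ℍ[ℂ]} (hf : IsInducedBy f F)
    (hF : IsHolomorphic F) : IsSliceRegular rightHalf f where
  slice x y I hI J hJ _ _ := by
    have h : I * I = -1 := hI
    rw [hf.eval_eq hJ, hf.eval_eq hI, hf.eval_neg hI]
    have h1 : J * I * (rePart (F ⟨x, y⟩) - I * imPart (F ⟨x, y⟩) -
        (rePart (F ⟨x, y⟩) + I * imPart (F ⟨x, y⟩))) = (2 : ℝ) • (J * imPart (F ⟨x, y⟩)) := by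
      have : rePart (F ⟨x, y⟩) - I * imPart (F ⟨x, y⟩) -
        (rePart (F ⟨x, y⟩) + I * imPart (F ⟨x, y⟩)) = (-2 : ℝ) • (I * imPart (F ⟨x, y⟩)) := by
        module
      rw [this, mul_smul_comm, mul_assoc, ← mul_assoc I I, h]
      simp
    rw [h1]
    module
  contDiff I hI := by
    have hset : {p : ℝ × ℝ | slicePt I p.1 p.2 ∈ rightHalf} = {p | 0 < p.1} := by
      ext p
      simp [rightHalf, slicePt_re hI]
    have hfun : (fun p : ℝ × ℝ => f (slicePt I p.1 p.2)) =
        fun p => sliceEval I (F ⟨p.1, p.2⟩) := funext fun p => hf.eval I hI p.1 p.2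
    rw [hset, hfun]
    unfold sliceEval
    exact (((contDiffOn_unitMap hF.re).add
      ((contDiffOn_unitMap hF.imI).mul contDiffOn_const)).add
      ((contDiffOn_unitMap hF.imJ).mul contDiffOn_const)).add
      ((contDiffOn_unitMap hF.imK).mul contDiffOn_const)
  cauchyRiemann I hI p hp := by
    have hp' : 0 ≤ p.1 := by
      have : 0 < (slicePt I p.1 p.2).re := hp
      rw [slicePt_re hI] at this
      exact this.le
    have hfun : (fun p : ℝ × ℝ => f (slicePt I p.1 p.2)) =
        fun p => sliceEval I (F ⟨p.1, p.2⟩) := funext fun p => hf.eval I hI p.1 p.2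
    obtain ⟨L0, h0, c0⟩ := exists_hasFDerivAt_unitMap hI (hF.re ⟨p.1, p.2⟩ hp')
    obtain ⟨L1, h1, c1⟩ := exists_hasFDerivAt_unitMap hI (hF.imI ⟨p.1, p.2⟩ hp')
    obtain ⟨L2, h2, c2⟩ := exists_hasFDerivAt_unitMap hI (hF.imJ ⟨p.1, p.2⟩ hp')
    obtain ⟨L3, h3, c3⟩ := exists_hasFDerivAt_unitMap hI (hF.imK ⟨p.1, p.2⟩ hp')
    have hD := ((h0.add (h1.mul_const' e₁)).add (h2.mul_const' e₂)).add (h3.mul_const' e₃)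
    rw [hfun]
    erw [hD.fderiv]
    have hsum : ∀ a0 a1 a2 a3 b0 b1 b2 b3 : ℍ[ℝ],
        a0 + a1 * e₁ + a2 * e₂ + a3 * e₃ + I * (b0 + b1 * e₁ + b2 * e₂ + b3 * e₃) =
        (a0 + I * b0) + (a1 + I * b1) * e₁ + (a2 + I * b2) * e₂ + (a3 + I * b3) * e₃ := by
      intros; noncomm_ring
    simp only [add_apply, smul_apply, op_smul_eq_mul, hsum, c0, c1, c2, c3]
    simp

/-! ### Boundary values and square means -/

lemma integrableOn_sin_fst :
    IntegrableOn (fun θ : ℝ × ℝ => sin θ.1) (Icc 0 π ×ˢ Icc 0 π) :=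
  (by fun_prop : Continuous fun θ : ℝ × ℝ => sin θ.1).continuousOn.integrableOn_compact
    (isCompact_Icc.prod isCompact_Icc)

instance : IsFiniteMeasure angleMeasure :=
  isFiniteMeasure_withDensity_ofReal integrableOn_sin_fst.2

lemma angleMeasure_real_univ : angleMeasure.real univ = 2 * π := by
  have hpos : 0 ≤ᵐ[volume.restrict (Icc 0 π ×ˢ Icc 0 π)] fun θ : ℝ × ℝ => sin θ.1 := by
    filter_upwards [ae_restrict_mem (measurableSet_Icc.prod measurableSet_Icc)] with θ hθ
    exact sin_nonneg_of_mem_Icc hθ.1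
  rw [measureReal_def, angleMeasure, withDensity_apply _ MeasurableSet.univ, Measure.restrict_univ,
    ← ofReal_integral_eq_lintegral_ofReal integrableOn_sin_fst hpos,
    ENNReal.toReal_ofReal (integral_nonneg_of_ae hpos)]
  have h := setIntegral_prod_mul (μ := (volume : Measure ℝ)) (ν := (volume : Measure ℝ))
    (fun x : ℝ => sin x) (fun _ : ℝ => (1 : ℝ)) (Icc 0 π) (Icc 0 π)
  simp only [mul_one] at h
  rw [Measure.volume_eq_prod, h, integral_Icc_eq_integral_Ioc,
    ← intervalIntegral.integral_of_le pi_pos.le, integral_sin]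
  simp [pi_pos.le]
  norm_num

lemma integrable_inv_one_add_sq_boundaryMeasure :
    Integrable (fun p : (ℝ × ℝ) × ℝ => (1 + p.2 ^ 2)⁻¹) boundaryMeasure :=
  integrable_inv_one_add_sq.comp_snd angleMeasure

lemma IsHolomorphic.continuous_sliceEval {F : ℂ → ℍ[ℂ]} (hF : IsHolomorphic F) :
    Continuous (fun p : (ℝ × ℝ) × ℝ => sliceEval (unitAt p.1) (F ⟨0, p.2⟩)) := by
  have key : ∀ c : ℂ → ℂ, (∀ z : ℂ, 0 ≤ z.re → DifferentiableAt ℂ c z) →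
      Continuous (fun p : (ℝ × ℝ) × ℝ => c ⟨0, p.2⟩) := fun c hc => by
    refine Continuous.comp (g := fun y : ℝ => c ⟨0, y⟩) ?_ continuous_snd
    rw [continuous_iff_continuousAt]
    intro y
    exact (hc ⟨0, y⟩ le_rfl).continuousAt.comp continuous_mk_zero.continuousAt
  have h0 := key _ hF.re
  have h1 := key _ hF.imI
  have h2 := key _ hF.imJ
  have h3 := key _ hF.imK
  have hu : unitAt = fun θ => (cos θ.1) • e₁ + (sin θ.1 * cos θ.2) • e₂ +
      (sin θ.1 * sin θ.2) • e₃ := by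
    funext θ
    ext <;> simp
  have hu' : Continuous unitAt := by rw [hu]; fun_prop
  have hcoe : Continuous (fun r : ℝ => (r : ℍ[ℝ])) := Quaternion.continuous_coe
  simp only [sliceEval, unitMap_apply]
  fun_prop

section
variable {f g : ℍ[ℝ] → ℍ[ℝ]} {F G : ℂ → ℍ[ℂ]}

lemma IsInducedBy.tendsto_boundary (hf : IsInducedBy f F) (hF : IsHolomorphic F)
    (p : (ℝ × ℝ) × ℝ) :
    Tendsto (fun x : ℝ => f (slicePt (unitAt p.1) x p.2)) (𝓝[>] (0 : ℝ))
      (𝓝 (sliceEval (unitAt p.1) (F ⟨0, p.2⟩))) := by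
  simp only [hf.eval _ (unitAt_mem_imagUnits p.1)]
  have hline : Continuous (fun x : ℝ => (⟨x, p.2⟩ : ℂ)) := by
    simp only [Complex.mk_eq_add_mul_I]
    fun_prop
  have key : ∀ c : ℂ → ℂ, (∀ z : ℂ, 0 ≤ z.re → DifferentiableAt ℂ c z) →
      Tendsto (fun x : ℝ => unitMap (unitAt p.1) (c ⟨x, p.2⟩)) (𝓝[>] (0 : ℝ))
        (𝓝 (unitMap (unitAt p.1) (c ⟨0, p.2⟩))) := fun c hc => by
    have h1 : ContinuousAt (fun x : ℝ => c ⟨x, p.2⟩) 0 :=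
      ContinuousAt.comp (g := c) (hc ⟨0, p.2⟩ le_rfl).continuousAt hline.continuousAt
    exact (((unitMap (unitAt p.1)).continuous.tendsto _).comp h1).mono_left nhdsWithin_le_nhds
  exact (((key _ hF.re).add ((key _ hF.imI).mul_const _)).add
    ((key _ hF.imJ).mul_const _)).add ((key _ hF.imK).mul_const _)

lemma IsInducedBy.boundaryValue_eq (hf : IsInducedBy f F) (hF : IsHolomorphic F) :
    boundaryValue f = fun p => sliceEval (unitAt p.1) (F ⟨0, p.2⟩) :=
  funext fun p => (hf.tendsto_boundary hF p).limUnder_eq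

lemma norm_sliceEval_unitAt_le (θ : ℝ × ℝ) (w : ℍ[ℂ]) :
    ‖sliceEval (unitAt θ) w‖ ≤ 2 * coordNorm w :=
  norm_sliceEval_le (norm_imagUnits (unitAt_mem_imagUnits θ)).le w

lemma IsInducedBy.memHardy (hf : IsInducedBy f F) (hF : IsHolomorphic F)
    (hd : IsDominatedBy F fun z => ‖z + 1‖⁻¹) : MemHardy f := by
  obtain ⟨K, hK⟩ := hd
  have hbound : ∀ (θ : ℝ × ℝ) (x y : ℝ), 0 ≤ x →
      ‖sliceEval (unitAt θ) (F ⟨x, y⟩)‖ ^ 2 ≤ 4 * K ^ 2 * (1 + y ^ 2)⁻¹ := by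
    intro θ x y hx
    have h1 := (norm_sliceEval_unitAt_le θ (F ⟨x, y⟩)).trans
      (mul_le_mul_of_nonneg_left (hK ⟨x, y⟩ hx) zero_le_two)
    calc ‖sliceEval (unitAt θ) (F ⟨x, y⟩)‖ ^ 2
        ≤ (2 * (K * ‖(⟨x, y⟩ : ℂ) + 1‖⁻¹)) ^ 2 := pow_le_pow_left₀ (norm_nonneg _) h1 2
      _ = 4 * K ^ 2 * (‖(⟨x, y⟩ : ℂ) + 1‖⁻¹ * ‖(⟨x, y⟩ : ℂ) + 1‖⁻¹) := by ring
      _ ≤ 4 * K ^ 2 * (1 + y ^ 2)⁻¹ := by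
          gcongr
          exact inv_norm_add_one_sq_le hx y
  have hint := integrable_inv_one_add_sq_boundaryMeasure.const_mul (4 * K ^ 2)
  refine ⟨hf.isSliceRegular hF, ?_, ?_, ?_⟩
  · have hfin : ∫⁻ p, ENNReal.ofReal (4 * K ^ 2 * (1 + p.2 ^ 2)⁻¹) ∂boundaryMeasure ≠ ⊤ :=
      hint.lintegral_lt_top.ne
    refine ⟨(∫⁻ p, ENNReal.ofReal (4 * K ^ 2 * (1 + p.2 ^ 2)⁻¹) ∂boundaryMeasure).toNNReal,
      fun x hx => ?_⟩
    rw [ENNReal.coe_toNNReal hfin]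
    refine lintegral_mono fun p => ?_
    rw [hf.eval _ (unitAt_mem_imagUnits p.1), ← ofReal_norm,
      ← ENNReal.ofReal_pow (norm_nonneg _)]
    exact ENNReal.ofReal_le_ofReal (hbound p.1 x p.2 hx.le)
  · exact Eventually.of_forall fun p => ⟨_, hf.tendsto_boundary hF p⟩
  · rw [hf.boundaryValue_eq hF]
    have hc := hF.continuous_sliceEval
    rw [memLp_two_iff_integrable_sq_norm hc.aestronglyMeasurable]
    refine hint.mono' (hc.norm.pow 2).aestronglyMeasurable (Eventually.of_forall fun p => ?_)
    rw [Real.norm_of_nonneg (sq_nonneg _)]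
    exact hbound p.1 0 p.2 le_rfl

/-! ### The inner product in terms of stem functions -/

/-- The part of `conj g · f` on `ℂ_I` that is even in `y`; it does not depend on `I`. -/
lemma star_sliceEval_mul_add {I : ℍ[ℝ]} (hI : I ∈ imagUnits) (v w : ℍ[ℂ]) :
    star (sliceEval I v) * sliceEval I w +
      star (sliceEval I (coeffConj v)) * sliceEval I (coeffConj w) =
      (2 : ℝ) • rePart (adj v * w) := by
  have h := star_mul_self_imagUnits hI
  have key : ∀ a b c d : ℍ[ℝ], (a + b * star I) * (c + I * d) +
      (a - b * star I) * (c - I * d) = 2 • (a * c + b * (star I * I) * d) := by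
    intros; noncomm_ring
  simp only [sliceEval_eq, rePart_coeffConj, imPart_coeffConj, rePart_adj_mul, star_add, star_sub,
    star_mul, mul_neg, ← sub_eq_add_neg]
  rw [key, h, mul_one, ← Nat.cast_smul_eq_nsmul ℝ, Nat.cast_ofNat]

lemma integrable_star_sliceEval_mul (hF : IsHolomorphic F) (hG : IsHolomorphic G)
    (hdF : IsDominatedBy F fun z => ‖z + 1‖⁻¹) (hdG : IsDominatedBy G fun z => ‖z + 1‖⁻¹) :
    Integrable (fun p : (ℝ × ℝ) × ℝ =>
        star (sliceEval (unitAt p.1) (G ⟨0, p.2⟩)) * sliceEval (unitAt p.1) (F ⟨0, p.2⟩))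
      boundaryMeasure ∧
    ∀ θ, Integrable (fun y : ℝ =>
        star (sliceEval (unitAt θ) (G ⟨0, y⟩)) * sliceEval (unitAt θ) (F ⟨0, y⟩)) := by
  obtain ⟨K, hK⟩ := hdF
  obtain ⟨M, hM⟩ := hdG
  have hbound : ∀ (θ : ℝ × ℝ) (y : ℝ),
      ‖star (sliceEval (unitAt θ) (G ⟨0, y⟩)) * sliceEval (unitAt θ) (F ⟨0, y⟩)‖ ≤
        4 * |M * K| * (1 + y ^ 2)⁻¹ := by
    intro θ y
    have h1 := (norm_sliceEval_unitAt_le θ (F ⟨0, y⟩)).trans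
      (mul_le_mul_of_nonneg_left (hK ⟨0, y⟩ le_rfl) zero_le_two)
    have h2 := (norm_sliceEval_unitAt_le θ (G ⟨0, y⟩)).trans
      (mul_le_mul_of_nonneg_left (hM ⟨0, y⟩ le_rfl) zero_le_two)
    rw [norm_mul, Quaternion.norm_star]
    calc ‖sliceEval (unitAt θ) (G ⟨0, y⟩)‖ * ‖sliceEval (unitAt θ) (F ⟨0, y⟩)‖
        ≤ (2 * (M * ‖(⟨0, y⟩ : ℂ) + 1‖⁻¹)) * (2 * (K * ‖(⟨0, y⟩ : ℂ) + 1‖⁻¹)) :=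
          mul_le_mul h2 h1 (norm_nonneg _) ((norm_nonneg _).trans h2)
      _ = 4 * (M * K) * (‖(⟨0, y⟩ : ℂ) + 1‖⁻¹ * ‖(⟨0, y⟩ : ℂ) + 1‖⁻¹) := by ring
      _ ≤ 4 * |M * K| * (1 + y ^ 2)⁻¹ := by
          gcongr
          · exact le_abs_self _
          · exact inv_norm_add_one_sq_le le_rfl y
  have hc := hG.continuous_sliceEval.star.mul hF.continuous_sliceEval
  refine ⟨(integrable_inv_one_add_sq_boundaryMeasure.const_mul (4 * |M * K|)).mono'
    hc.aestronglyMeasurable (Eventually.of_forall fun p => hbound p.1 p.2), fun θ =>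
    (integrable_inv_one_add_sq.const_mul (4 * |M * K|)).mono'
    (hc.comp (Continuous.prodMk_right θ)).aestronglyMeasurable
    (Eventually.of_forall fun y => hbound θ y)⟩

/-- The odd part in `y` of the integrand drops out, so that all slices contribute equally. -/
lemma IsInducedBy.hardyInner_eq (hf : IsInducedBy f F) (hg : IsInducedBy g G)
    (hF : IsHolomorphic F) (hG : IsHolomorphic G)
    (hdF : IsDominatedBy F fun z => ‖z + 1‖⁻¹) (hdG : IsDominatedBy G fun z => ‖z + 1‖⁻¹) :
    hardyInner f g = ∫ y : ℝ, rePart (adj (G ⟨0, y⟩) * F ⟨0, y⟩) := by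
  obtain ⟨hint, hintθ⟩ := integrable_star_sliceEval_mul hF hG hdF hdG
  have hslice : ∀ θ, ∫ y : ℝ,
      star (sliceEval (unitAt θ) (G ⟨0, y⟩)) * sliceEval (unitAt θ) (F ⟨0, y⟩) =
      ∫ y : ℝ, rePart (adj (G ⟨0, y⟩) * F ⟨0, y⟩) := by
    intro θ
    set h : ℝ → ℍ[ℝ] := fun y =>
      star (sliceEval (unitAt θ) (G ⟨0, y⟩)) * sliceEval (unitAt θ) (F ⟨0, y⟩) with hh
    have hsum : ∀ y, h y + h (-y) = (2 : ℝ) • rePart (adj (G ⟨0, y⟩) * F ⟨0, y⟩) := by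
      intro y
      have : (⟨0, -y⟩ : ℂ) = conj (⟨0, y⟩ : ℂ) := by apply Complex.ext <;> simp
      simp only [hh, this, hf.symm, hg.symm]
      exact star_sliceEval_mul_add (unitAt_mem_imagUnits θ) _ _
    have h2 : (2 : ℝ) • ∫ y, h y = (2 : ℝ) • ∫ y : ℝ, rePart (adj (G ⟨0, y⟩) * F ⟨0, y⟩) := by
      rw [← integral_smul (2 : ℝ) (fun y : ℝ => rePart (adj (G ⟨0, y⟩) * F ⟨0, y⟩)),
        ← integral_congr_ae (Eventually.of_forall hsum), integral_add (hintθ θ) (hintθ θ).comp_neg, integral_neg_eq_self h, two_smul]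
    exact smul_right_injective _ two_ne_zero h2
  rw [hardyInner, hf.boundaryValue_eq hF, hg.boundaryValue_eq hG]
  have hprod := integral_prod _ (show Integrable _ (angleMeasure.prod volume) from hint)
  rw [boundaryMeasure, hprod]
  simp only [hslice]
  rw [integral_const, angleMeasure_real_univ, smul_smul, one_div,
    inv_mul_cancel₀ (by positivity), one_smul]

/-! ### Cauchy's theorem on the right half plane -/

/-- Cauchy's theorem on the rectangles `[0, R] × [-R, R]`: the other three sides contribute
`O (1 / R)`. -/
lemma integral_imaginary_axis_eq_zero {c : ℂ → ℂ} {K : ℝ}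
    (hc : ∀ z : ℂ, 0 ≤ z.re → DifferentiableAt ℂ c z)
    (hK : ∀ z : ℂ, 0 ≤ z.re → ‖c z‖ ≤ K * (‖z + 1‖⁻¹ * ‖z + 1‖⁻¹)) :
    Integrable (fun y : ℝ => c ⟨0, y⟩) ∧ ∫ y : ℝ, c ⟨0, y⟩ = 0 := by
  have hK0 : 0 ≤ K := by
    have := (norm_nonneg _).trans (hK 0 le_rfl)
    simpa using this
  have hcont : Continuous (fun y : ℝ => c ⟨0, y⟩) := by
    rw [continuous_iff_continuousAt]
    intro y
    exact (hc ⟨0, y⟩ le_rfl).continuousAt.comp continuous_mk_zero.continuousAt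
  have hint : Integrable (fun y : ℝ => c ⟨0, y⟩) := by
    refine (integrable_inv_one_add_sq.const_mul K).mono' hcont.aestronglyMeasurable
      (Eventually.of_forall fun y => (hK ⟨0, y⟩ le_rfl).trans ?_)
    exact mul_le_mul_of_nonneg_left (inv_norm_add_one_sq_le le_rfl y) hK0
  refine ⟨hint, ?_⟩
  have hlim := intervalIntegral_tendsto_integral hint tendsto_neg_atTop_atBot tendsto_id
  refine tendsto_nhds_unique hlim ?_
  have hfar : ∀ R : ℝ, 0 < R → ∀ z : ℂ, 0 ≤ z.re → R ≤ ‖z + 1‖ → ‖c z‖ ≤ K / R ^ 2 := by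
    intro R hR z hz hzR
    refine (hK z hz).trans ?_
    rw [div_eq_mul_inv, sq, mul_inv]
    gcongr
  have hside : ∀ R : ℝ, 0 < R → ‖∫ y in (-R)..R, c ⟨0, y⟩‖ ≤ 4 * K / R := by
    intro R hR
    have hrect := Complex.integral_boundary_rect_eq_zero_of_differentiableOn c ⟨0, -R⟩ ⟨R, R⟩
      (fun z hz => (hc z (by
        have := hz.1
        simp only [uIcc_of_le hR.le, mem_preimage, mem_Icc] at this
        exact this.1)).differentiableWithinAt)
    simp only [← Complex.mk_eq_add_mul_I] at hrect
    have b1 : ‖∫ x in (0 : ℝ)..R, c ⟨x, -R⟩‖ ≤ K / R ^ 2 * |R - 0| := by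
      refine intervalIntegral.norm_integral_le_of_norm_le_const fun x hx => ?_
      rw [uIoc_of_le hR.le] at hx
      refine hfar R hR _ hx.1.le ?_
      have := Complex.abs_im_le_norm ((⟨x, -R⟩ : ℂ) + 1)
      simpa [abs_of_pos hR] using this
    have b2 : ‖∫ x in (0 : ℝ)..R, c ⟨x, R⟩‖ ≤ K / R ^ 2 * |R - 0| := by
      refine intervalIntegral.norm_integral_le_of_norm_le_const fun x hx => ?_
      rw [uIoc_of_le hR.le] at hx
      refine hfar R hR _ hx.1.le ?_
      have := Complex.abs_im_le_norm ((⟨x, R⟩ : ℂ) + 1)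
      simpa [abs_of_pos hR] using this
    have b3 : ‖∫ y in (-R)..R, c ⟨R, y⟩‖ ≤ K / R ^ 2 * |R - -R| := by
      refine intervalIntegral.norm_integral_le_of_norm_le_const fun y _ => ?_
      refine hfar R hR _ hR.le ?_
      have := Complex.re_le_norm ((⟨R, y⟩ : ℂ) + 1)
      simp at this
      linarith
    have heq : ∫ y in (-R)..R, c ⟨0, y⟩ = (∫ y in (-R)..R, c ⟨R, y⟩) +
        -Complex.I * ((∫ x in (0 : ℝ)..R, c ⟨x, -R⟩) - ∫ x in (0 : ℝ)..R, c ⟨x, R⟩) := by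
      simp only [smul_eq_mul] at hrect
      linear_combination Complex.I * hrect +
        ((∫ y in (-R)..R, c ⟨0, y⟩) - (∫ y in (-R)..R, c ⟨R, y⟩)) * Complex.I_mul_I
    rw [heq]
    refine (norm_add_le _ _).trans ?_
    rw [norm_mul, norm_neg, Complex.norm_I, one_mul]
    have b4 := norm_sub_le (∫ x in (0 : ℝ)..R, c ⟨x, -R⟩) (∫ x in (0 : ℝ)..R, c ⟨x, R⟩)
    have e1 : K / R ^ 2 * |R - 0| = K / R := by
      rw [sub_zero, abs_of_pos hR]; field_simp
    have e2 : K / R ^ 2 * |R - -R| = 2 * (K / R) := by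
      rw [sub_neg_eq_add, abs_of_pos (by linarith)]; field_simp; ring
    have e3 : 4 * K / R = 4 * (K / R) := by ring
    rw [e1] at b1 b2
    rw [e2] at b3
    linarith
  refine squeeze_zero_norm' ?_ (tendsto_const_nhds.div_atTop tendsto_id : Tendsto
    (fun R : ℝ => 4 * K / R) atTop (𝓝 0))
  filter_upwards [eventually_gt_atTop 0] with R hR using hside R hR

lemma IsHolomorphic.integral_rePart_eq_zero (hF : IsHolomorphic F)
    (hd : IsDominatedBy F fun z => ‖z + 1‖⁻¹ * ‖z + 1‖⁻¹) :
    ∫ y : ℝ, rePart (F ⟨0, y⟩) = 0 := by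
  obtain ⟨K, hK⟩ := hd
  have key : ∀ c : ℂ → ℂ, (∀ z : ℂ, 0 ≤ z.re → DifferentiableAt ℂ c z) →
      (∀ z : ℂ, ‖c z‖ ≤ coordNorm (F z)) →
      Integrable (fun y : ℝ => unitMap 0 (c ⟨0, y⟩)) ∧
        ∫ y : ℝ, unitMap 0 (c ⟨0, y⟩) = 0 := by
    intro c hc hle
    obtain ⟨h1, h2⟩ := integral_imaginary_axis_eq_zero hc
      (fun z hz => (hle z).trans (hK z hz))
    exact ⟨(unitMap 0).integrable_comp h1, by
      rw [(unitMap 0).integral_comp_comm h1, h2, map_zero]⟩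
  obtain ⟨i0, h0⟩ := key _ hF.re fun z => norm_re_le_coordNorm _
  obtain ⟨i1, h1⟩ := key _ hF.imI fun z => norm_imI_le_coordNorm _
  obtain ⟨i2, h2⟩ := key _ hF.imJ fun z => norm_imJ_le_coordNorm _
  obtain ⟨i3, h3⟩ := key _ hF.imK fun z => norm_imK_le_coordNorm _
  simp only [← sliceEval_zero, sliceEval]
  have j1 := i1.mul_const e₁
  have j2 := i2.mul_const e₂
  have j3 := i3.mul_const e₃
  have k1 := i0.fun_add j1
  have k2 := k1.fun_add j2
  rw [integral_add k2 j3, integral_add k1 j2, integral_add i0 j1,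
    integral_mul_const_of_integrable i1, integral_mul_const_of_integrable i2,
    integral_mul_const_of_integrable i3, h0, h1, h2, h3]
  simp

end

/-! ### Stem functions of the kernels and of the Blaschke factors -/

/-- The complex polynomial `z ^ 2 + 2 Re(a) z + |a| ^ 2`, which induces the symmetrization of
`q + ā`. -/
def symPoly (a : ℍ[ℝ]) (z : ℂ) : ℂ :=
  z ^ 2 + 2 * a.re * z + (a.re ^ 2 + a.imI ^ 2 + a.imJ ^ 2 + a.imK ^ 2 : ℝ)

/-- The stem function of `(q + ā)^{-*}`. -/
def kernelStem (a : ℍ[ℝ]) (z : ℂ) : ℍ[ℂ] := (symPoly a z)⁻¹ • ((z : ℍ[ℂ]) + complexify a)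

/-- The stem function of the normalized Szegő kernel. -/
def szegoStem (a : ℍ[ℝ]) (z : ℂ) : ℍ[ℂ] := ((√(a.re / π) : ℝ) : ℂ) • kernelStem a z

/-- The stem function of the Blaschke factor. -/
def factorStem (a : ℍ[ℝ]) (z : ℂ) : ℍ[ℂ] := kernelStem a z * ((z : ℍ[ℂ]) - complexify a)

/-- The stem function of the ordered product of the Blaschke factors of `a 1, …, a n`. -/
def productStem (a : ℕ → ℍ[ℝ]) : ℕ → ℂ → ℍ[ℂ]
  | 0 => fun _ => 1
  | n + 1 => fun z => productStem a n z * factorStem (a (n + 1)) z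

/-- The stem function of `T_{n+1}`. -/
def tmStem (a : ℕ → ℍ[ℝ]) (n : ℕ) (z : ℂ) : ℍ[ℂ] :=
  productStem a n z * szegoStem (a (n + 1)) z

lemma isInducedBy_regInv_add_star (a : ℍ[ℝ]) :
    IsInducedBy (regInv fun s => s + star a) (kernelStem a) := by
  have h := (isInducedBy_add_const (star a)).regInv (n := symPoly a) fun z => by
    ext : 1 <;> simp [symPoly, sq] <;> ring
  have hstar : ∀ z : ℂ, star ((z : ℍ[ℂ]) + complexify (star a)) = (z : ℍ[ℂ]) + complexify a := by
    intro z
    ext : 1 <;> simp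
  simp only [hstar] at h
  exact h

lemma isInducedBy_szego (a : ℍ[ℝ]) : IsInducedBy (szego a) (szegoStem a) :=
  (isInducedBy_regInv_add_star a).real_smul _

lemma isInducedBy_blaschkeFactor (a : ℍ[ℝ]) : IsInducedBy (blaschkeFactor a) (factorStem a) :=
  (isInducedBy_regInv_add_star a).starMul (isInducedBy_sub_const a)

lemma isInducedBy_starProd (a : ℕ → ℍ[ℝ]) (n : ℕ) :
    IsInducedBy (starProd (fun j => blaschkeFactor (a j)) n) (productStem a n) := by
  induction n with
  | zero => exact isInducedBy_one
  | succ n ih => exact ih.starMul (isInducedBy_blaschkeFactor (a (n + 1)))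

lemma isInducedBy_tmSystem (a : ℕ → ℍ[ℝ]) (n : ℕ) :
    IsInducedBy (tmSystem a (n + 1)) (tmStem a n) :=
  (isInducedBy_starProd a n).starMul (isInducedBy_szego (a (n + 1)))

lemma symPoly_eq_mul (a : ℍ[ℝ]) (z : ℂ) :
    symPoly a z = (z + ⟨a.re, √(a.imI ^ 2 + a.imJ ^ 2 + a.imK ^ 2)⟩) *
      (z + ⟨a.re, -√(a.imI ^ 2 + a.imJ ^ 2 + a.imK ^ 2)⟩) := by
  have hv : √(a.imI ^ 2 + a.imJ ^ 2 + a.imK ^ 2) ^ 2 = a.imI ^ 2 + a.imJ ^ 2 + a.imK ^ 2 :=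
    sq_sqrt (by positivity)
  set v := √(a.imI ^ 2 + a.imJ ^ 2 + a.imK ^ 2)
  have hv' : (a.re ^ 2 + a.imI ^ 2 + a.imJ ^ 2 + a.imK ^ 2 : ℝ) = a.re ^ 2 + v ^ 2 := by
    rw [hv]; ring
  rw [symPoly, hv', Complex.mk_eq_add_mul_I, Complex.mk_eq_add_mul_I]
  push_cast
  linear_combination (v : ℂ) ^ 2 * Complex.I_sq

lemma norm_add_one_le {b z : ℂ} (hb : 0 < b.re) (hz : 0 ≤ z.re) :
    ‖z + 1‖ ≤ (1 + ‖1 - b‖ / b.re) * ‖z + b‖ := by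
  have h1 : b.re ≤ ‖z + b‖ := by
    have := Complex.re_le_norm (z + b)
    simp at this
    linarith
  have h2 : ‖z + 1‖ ≤ ‖z + b‖ + ‖1 - b‖ := by
    have := norm_add_le (z + b) (1 - b)
    rwa [show z + b + (1 - b) = z + 1 by ring] at this
  have h3 : ‖1 - b‖ ≤ ‖1 - b‖ / b.re * ‖z + b‖ := by
    rw [div_mul_eq_mul_div, le_div_iff₀ hb]
    gcongr
  linarith

/-- `symPoly a` grows like `|z| ^ 2`; in particular it has no zero in the closed right half
plane. -/
lemma exists_sq_norm_le_symPoly {a : ℍ[ℝ]} (ha : a ∈ rightHalf) :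
    ∃ K : ℝ, ∀ z : ℂ, 0 ≤ z.re → ‖z + 1‖ * ‖z + 1‖ ≤ K * ‖symPoly a z‖ := by
  refine ⟨(1 + ‖1 - (⟨a.re, √(a.imI ^ 2 + a.imJ ^ 2 + a.imK ^ 2)⟩ : ℂ)‖ / a.re) *
    (1 + ‖1 - (⟨a.re, -√(a.imI ^ 2 + a.imJ ^ 2 + a.imK ^ 2)⟩ : ℂ)‖ / a.re), fun z hz => ?_⟩
  have h1 := norm_add_one_le (b := ⟨a.re, √(a.imI ^ 2 + a.imJ ^ 2 + a.imK ^ 2)⟩) ha hz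
  have h2 := norm_add_one_le (b := ⟨a.re, -√(a.imI ^ 2 + a.imJ ^ 2 + a.imK ^ 2)⟩) ha hz
  -- Both roots of `symPoly a` have real part `-Re a < 0`.
  rw [symPoly_eq_mul, norm_mul]
  refine (mul_le_mul h1 h2 (norm_nonneg _) ((norm_nonneg _).trans h1)).trans_eq ?_
  ring

lemma symPoly_ne_zero {a : ℍ[ℝ]} (ha : a ∈ rightHalf) {z : ℂ} (hz : 0 ≤ z.re) :
    symPoly a z ≠ 0 := by
  obtain ⟨K, hK⟩ := exists_sq_norm_le_symPoly ha
  intro h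
  have h1 := hK z hz
  rw [h, norm_zero, mul_zero] at h1
  nlinarith [one_le_norm_add_one hz]

lemma isHolomorphic_kernelStem {a : ℍ[ℝ]} (ha : a ∈ rightHalf) :
    IsHolomorphic (kernelStem a) :=
  (IsHolomorphic.coe_add _).smul fun z hz => by
    refine DifferentiableAt.inv ?_ (symPoly_ne_zero ha hz)
    unfold symPoly
    fun_prop

lemma isHolomorphic_szegoStem {a : ℍ[ℝ]} (ha : a ∈ rightHalf) : IsHolomorphic (szegoStem a) :=
  (isHolomorphic_kernelStem ha).smul fun _ _ => differentiableAt_const _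

lemma isHolomorphic_factorStem {a : ℍ[ℝ]} (ha : a ∈ rightHalf) : IsHolomorphic (factorStem a) :=
  (isHolomorphic_kernelStem ha).mul (IsHolomorphic.coe_sub _)

lemma coordNorm_coe_add_le (w : ℍ[ℂ]) {z : ℂ} (hz : 0 ≤ z.re) :
    coordNorm ((z : ℍ[ℂ]) + w) ≤ (2 + coordNorm w) * ‖z + 1‖ := by
  have h1 := coordNorm_add_le (z : ℍ[ℂ]) w
  rw [coordNorm_coe] at h1
  have h2 : ‖z‖ ≤ ‖z + 1‖ + 1 := by
    have := norm_sub_le (z + 1) 1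
    rwa [add_sub_cancel_right, norm_one] at this
  nlinarith [one_le_norm_add_one hz, coordNorm_nonneg w]

lemma isDominatedBy_kernelStem {a : ℍ[ℝ]} (ha : a ∈ rightHalf) :
    IsDominatedBy (kernelStem a) fun z => ‖z + 1‖⁻¹ := by
  obtain ⟨K, hK⟩ := exists_sq_norm_le_symPoly ha
  refine ⟨K * (2 + coordNorm (complexify a)), fun z hz => ?_⟩
  have hs : 0 < ‖symPoly a z‖ := norm_pos_iff.mpr (symPoly_ne_zero ha hz)
  have h1 : 0 < ‖z + 1‖ := one_pos.trans_le (one_le_norm_add_one hz)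
  have hK0 : 0 < K :=
    pos_of_mul_pos_left ((by positivity : 0 < ‖z + 1‖ * ‖z + 1‖).trans_le (hK z hz)) hs.le
  have h2 : ‖symPoly a z‖⁻¹ ≤ K * (‖z + 1‖⁻¹ * ‖z + 1‖⁻¹) := by
    rw [← mul_inv, ← div_eq_mul_inv, inv_le_comm₀ hs (by positivity), inv_div, div_le_iff₀ hK0,
      mul_comm _ K]
    exact hK z hz
  rw [kernelStem, coordNorm_smul, norm_inv]
  calc ‖symPoly a z‖⁻¹ * coordNorm ((z : ℍ[ℂ]) + complexify a)
      ≤ (K * (‖z + 1‖⁻¹ * ‖z + 1‖⁻¹)) * ((2 + coordNorm (complexify a)) * ‖z + 1‖) :=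
        mul_le_mul h2 (coordNorm_coe_add_le _ hz) (coordNorm_nonneg _)
          ((by positivity : 0 ≤ ‖symPoly a z‖⁻¹).trans h2)
    _ = K * (2 + coordNorm (complexify a)) * ‖z + 1‖⁻¹ := by
        field_simp

lemma isDominatedBy_szegoStem {a : ℍ[ℝ]} (ha : a ∈ rightHalf) :
    IsDominatedBy (szegoStem a) fun z => ‖z + 1‖⁻¹ := by
  obtain ⟨K, hK⟩ := isDominatedBy_kernelStem ha
  refine ⟨‖((√(a.re / π) : ℝ) : ℂ)‖ * K, fun z hz => ?_⟩
  rw [szegoStem, coordNorm_smul, mul_assoc]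
  exact mul_le_mul_of_nonneg_left (hK z hz) (norm_nonneg _)

lemma isDominatedBy_factorStem {a : ℍ[ℝ]} (ha : a ∈ rightHalf) :
    IsDominatedBy (factorStem a) fun _ => 1 := by
  have h : IsDominatedBy (fun z => (z : ℍ[ℂ]) - complexify a) fun z => ‖z + 1‖ :=
    ⟨2 + coordNorm (-complexify a), fun z hz => by
      simpa only [sub_eq_add_neg] using coordNorm_coe_add_le (-complexify a) hz⟩
  obtain ⟨K, hK⟩ := (isDominatedBy_kernelStem ha).mul h
  refine ⟨K, fun z hz => ?_⟩
  have h1 : 0 < ‖z + 1‖ := one_pos.trans_le (one_le_norm_add_one hz)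
  have h2 := hK z hz
  simp only [inv_mul_cancel₀ h1.ne'] at h2
  exact h2

lemma productStem_isHolomorphic_isDominatedBy {a : ℕ → ℍ[ℝ]}
    (ha : ∀ k, 1 ≤ k → a k ∈ rightHalf) (n : ℕ) :
    IsHolomorphic (productStem a n) ∧ IsDominatedBy (productStem a n) fun _ => 1 := by
  induction n with
  | zero => exact ⟨IsHolomorphic.const 1, coordNorm 1, fun z _ => by simp [productStem]⟩
  | succ n ih =>
    have hn := ha (n + 1) (Nat.le_add_left 1 n)
    refine ⟨ih.1.mul (isHolomorphic_factorStem hn), ?_⟩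
    have h := ih.2.mul (isDominatedBy_factorStem hn)
    simp only [mul_one] at h
    exact h

lemma tmStem_isHolomorphic_isDominatedBy {a : ℕ → ℍ[ℝ]}
    (ha : ∀ k, 1 ≤ k → a k ∈ rightHalf) (n : ℕ) :
    IsHolomorphic (tmStem a n) ∧ IsDominatedBy (tmStem a n) fun z => ‖z + 1‖⁻¹ := by
  have hn := ha (n + 1) (Nat.le_add_left 1 n)
  obtain ⟨h1, h2⟩ := productStem_isHolomorphic_isDominatedBy ha n
  refine ⟨h1.mul (isHolomorphic_szegoStem hn), ?_⟩
  have h := h2.mul (isDominatedBy_szegoStem hn)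
  simp only [one_mul] at h
  exact h

/-! ### The system on the imaginary axis -/

-- The next five facts are checked by coordinates: an instance of `IsScalarTower ℂ ℍ[ℂ] ℍ[ℂ]` is not
-- available, and `rw` does not identify the negation of `ℍ[ℂ]` with that of its ring structure.
lemma smul_mul_eq (c : ℂ) (v w : ℍ[ℂ]) : c • v * w = c • (v * w) := by
  ext : 1 <;> simp <;> ring

lemma mul_smul_eq (c : ℂ) (v w : ℍ[ℂ]) : v * c • w = c • (v * w) := by
  ext : 1 <;> simp <;> ring

lemma neg_mul_eq (v w : ℍ[ℂ]) : -v * w = -(v * w) := by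
  ext : 1 <;> simp <;> ring

lemma mul_neg_eq (v w : ℍ[ℂ]) : v * -w = -(v * w) := by
  ext : 1 <;> simp <;> ring

lemma neg_smul_eq (c : ℂ) (w : ℍ[ℂ]) : -c • w = -(c • w) := by
  ext : 1 <;> simp

lemma adj_smul (c : ℂ) (w : ℍ[ℂ]) : adj (c • w) = conj c • adj w := by
  rw [adj, coeffConj_smul, adj, Quaternion.star_smul]

lemma conj_symPoly (a : ℍ[ℝ]) (z : ℂ) : conj (symPoly a z) = symPoly a (conj z) := by
  simp [symPoly, Complex.conj_ofNat]

lemma conj_mk_zero (y : ℝ) : conj (⟨0, y⟩ : ℂ) = -⟨0, y⟩ := by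
  apply Complex.ext <;> simp

lemma symPoly_neg_axis_ne_zero {a : ℍ[ℝ]} (ha : a ∈ rightHalf) (y : ℝ) :
    symPoly a (-⟨0, y⟩) ≠ 0 := by
  rw [← conj_mk_zero, ← conj_symPoly]
  exact (map_ne_zero _).mpr (symPoly_ne_zero ha le_rfl)

lemma adj_kernelStem_axis (a : ℍ[ℝ]) (y : ℝ) :
    adj (kernelStem a ⟨0, y⟩) = (symPoly a (-⟨0, y⟩))⁻¹ •
      (complexify (star a) - ((⟨0, y⟩ : ℂ) : ℍ[ℂ])) := by
  rw [kernelStem, adj_smul, map_inv₀, conj_symPoly, conj_mk_zero]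
  congr 1
  rw [adj, coeffConj_add, coeffConj_coe, coeffConj_complexify, conj_mk_zero]
  ext : 1 <;> simp
  ring

/-- On the imaginary axis `e_a† C_a = -e_a`: the poles of `e_a†` in the right
half plane are cancelled by the zeros of `C_a`. -/
lemma adj_kernelStem_mul_factorStem {a : ℍ[ℝ]} (ha : a ∈ rightHalf) (y : ℝ) :
    adj (kernelStem a ⟨0, y⟩) * factorStem a ⟨0, y⟩ = -kernelStem a ⟨0, y⟩ := by
  have h0 := symPoly_neg_axis_ne_zero ha y
  rw [adj_kernelStem_axis, factorStem, kernelStem]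
  generalize (⟨0, y⟩ : ℂ) = z at *
  have h : (complexify (star a) - (z : ℍ[ℂ])) * (((z : ℍ[ℂ]) + complexify a) *
      ((z : ℍ[ℂ]) - complexify a)) = -(symPoly a (-z) • ((z : ℍ[ℂ]) + complexify a)) := by
    ext : 1 <;> simp [symPoly, sq] <;> ring
  rw [smul_mul_eq, smul_mul_eq, mul_smul_eq, h, smul_neg, smul_neg,
    smul_comm (symPoly a z)⁻¹, inv_smul_smul₀ h0]

/-- `C_a` is unitary on the imaginary axis. -/
lemma adj_factorStem_mul_self {a : ℍ[ℝ]} (ha : a ∈ rightHalf) (y : ℝ) :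
    adj (factorStem a ⟨0, y⟩) * factorStem a ⟨0, y⟩ = 1 := by
  have h0 : symPoly a ⟨0, y⟩ ≠ 0 := symPoly_ne_zero ha le_rfl
  have hadj : adj (((⟨0, y⟩ : ℂ) : ℍ[ℂ]) - complexify a) =
      -(((⟨0, y⟩ : ℂ) : ℍ[ℂ]) + complexify (star a)) := by
    rw [adj, coeffConj_sub, coeffConj_coe, coeffConj_complexify, conj_mk_zero]
    ext : 1 <;> simp
    ring
  have h1 : adj (factorStem a ⟨0, y⟩) = adj (((⟨0, y⟩ : ℂ) : ℍ[ℂ]) - complexify a) *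
      adj (kernelStem a ⟨0, y⟩) := adj_mul _ _
  rw [h1, mul_assoc, adj_kernelStem_mul_factorStem ha, hadj, neg_mul_eq, mul_neg_eq, neg_neg,
    kernelStem]
  generalize (⟨0, y⟩ : ℂ) = z at *
  have h : ((z : ℍ[ℂ]) + complexify (star a)) * ((z : ℍ[ℂ]) + complexify a) =
      symPoly a z • (1 : ℍ[ℂ]) := by
    ext : 1 <;> simp [symPoly, sq] <;> ring
  rw [mul_smul_eq, h, inv_smul_smul₀ h0]

lemma adj_productStem_mul_self {a : ℕ → ℍ[ℝ]} (ha : ∀ k, 1 ≤ k → a k ∈ rightHalf) (n : ℕ)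
    (y : ℝ) : adj (productStem a n ⟨0, y⟩) * productStem a n ⟨0, y⟩ = 1 := by
  induction n with
  | zero => simp [productStem, adj, coeffConj_one]
  | succ n ih =>
    rw [productStem, adj_mul, mul_assoc, ← mul_assoc (adj (productStem a n _)), ih, one_mul,
      adj_factorStem_mul_self (ha _ (Nat.le_add_left 1 n))]

lemma productStem_add (a : ℕ → ℍ[ℝ]) (n m : ℕ) (z : ℂ) :
    productStem a (n + m) z = productStem a n z * productStem (fun j => a (n + j)) m z := by
  induction m with
  | zero => simp [productStem]
  | succ m ih =>
    change productStem a (n + m) z * factorStem (a (n + (m + 1))) z = _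
    rw [ih, mul_assoc]
    rfl

/-- For `k < l` the integrand of `⟨T_l, T_k⟩` extends holomorphically to the right half plane. -/
lemma adj_tmStem_mul_tmStem {a : ℕ → ℍ[ℝ]} (ha : ∀ k, 1 ≤ k → a k ∈ rightHalf) (n m : ℕ)
    (y : ℝ) : adj (tmStem a n ⟨0, y⟩) * tmStem a (n + 1 + m) ⟨0, y⟩ =
      ((-√((a (n + 1)).re / π) : ℝ) : ℂ) • kernelStem (a (n + 1)) ⟨0, y⟩ *
        tmStem (fun j => a (n + 1 + j)) m ⟨0, y⟩ := by
  have hn := ha (n + 1) (Nat.le_add_left 1 n)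
  have h := adj_kernelStem_mul_factorStem hn y
  have hu := adj_productStem_mul_self ha n y
  have hadj : adj (tmStem a n ⟨0, y⟩) = ((√((a (n + 1)).re / π) : ℝ) : ℂ) •
      (adj (kernelStem (a (n + 1)) ⟨0, y⟩) * adj (productStem a n ⟨0, y⟩)) := by
    rw [tmStem, adj_mul, szegoStem, adj_smul, Complex.conj_ofReal, smul_mul_eq]
  have hsplit : tmStem a (n + 1 + m) ⟨0, y⟩ = productStem a n ⟨0, y⟩ *
      (factorStem (a (n + 1)) ⟨0, y⟩ * tmStem (fun j => a (n + 1 + j)) m ⟨0, y⟩) := by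
    rw [tmStem, productStem_add]
    change productStem a n ⟨0, y⟩ * factorStem (a (n + 1)) ⟨0, y⟩ * _ * _ = _
    simp only [mul_assoc]
    rfl
  rw [hadj, hsplit, smul_mul_eq, mul_assoc, ← mul_assoc (adj (productStem a n _)), hu, one_mul,
    ← mul_assoc, h, smul_mul_eq, neg_mul_eq, smul_neg, Complex.ofReal_neg, neg_smul_eq]

lemma rePart_adj_kernelStem_mul_self {a : ℍ[ℝ]} (ha : a ∈ rightHalf) (y : ℝ) :
    rePart (adj (kernelStem a ⟨0, y⟩) * kernelStem a ⟨0, y⟩) =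
      ((1 / 2 * (((y - √(a.imI ^ 2 + a.imJ ^ 2 + a.imK ^ 2)) ^ 2 + a.re ^ 2)⁻¹ +
        ((y + √(a.imI ^ 2 + a.imJ ^ 2 + a.imK ^ 2)) ^ 2 + a.re ^ 2)⁻¹) : ℝ) : ℍ[ℝ]) := by
  have ha' : 0 < a.re := ha
  have hn : symPoly a (-⟨0, y⟩) * symPoly a ⟨0, y⟩ =
      ((((y - √(a.imI ^ 2 + a.imJ ^ 2 + a.imK ^ 2)) ^ 2 + a.re ^ 2) *
        ((y + √(a.imI ^ 2 + a.imJ ^ 2 + a.imK ^ 2)) ^ 2 + a.re ^ 2) : ℝ) : ℂ) := by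
    rw [symPoly_eq_mul, symPoly_eq_mul]
    apply Complex.ext <;> simp [sq] <;> ring
  have hv : √(a.imI ^ 2 + a.imJ ^ 2 + a.imK ^ 2) ^ 2 = a.imI ^ 2 + a.imJ ^ 2 + a.imK ^ 2 :=
    sq_sqrt (by positivity)
  have hre : rePart ((complexify (star a) - ((⟨0, y⟩ : ℂ) : ℍ[ℂ])) *
      (((⟨0, y⟩ : ℂ) : ℍ[ℂ]) + complexify a)) =
      ((y ^ 2 + a.re ^ 2 + √(a.imI ^ 2 + a.imJ ^ 2 + a.imK ^ 2) ^ 2 : ℝ) : ℍ[ℝ]) := by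
    rw [hv]
    ext <;> simp [sq] <;> ring
  have hsmul : ∀ (r : ℝ) (w : ℍ[ℂ]), rePart ((r : ℂ) • w) = r • rePart w := by
    intro r w
    ext <;> simp
  rw [adj_kernelStem_axis, kernelStem, smul_mul_eq, mul_smul_eq, smul_smul, ← mul_inv, hn,
    ← Complex.ofReal_inv, hsmul, hre, ← Quaternion.coe_smul]
  congr 1
  rw [smul_eq_mul]
  generalize √(a.imI ^ 2 + a.imJ ^ 2 + a.imK ^ 2) = v
  have h1 : (y - v) ^ 2 + a.re ^ 2 ≠ 0 := by positivity
  have h2 : (y + v) ^ 2 + a.re ^ 2 ≠ 0 := by positivity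
  field_simp
  ring

/-! ### Orthonormality -/

lemma integrable_inv_sq_add_sq_and_integral {r : ℝ} (hr : 0 < r) (v : ℝ) :
    Integrable (fun y : ℝ => ((y - v) ^ 2 + r ^ 2)⁻¹) ∧
      ∫ y : ℝ, ((y - v) ^ 2 + r ^ 2)⁻¹ = π / r := by
  have hfun : (fun y : ℝ => ((y - v) ^ 2 + r ^ 2)⁻¹) =
      fun y => (r ^ 2)⁻¹ * (fun u : ℝ => (1 + (u / r) ^ 2)⁻¹) (y - v) := by
    funext y
    have h1 : (y - v) ^ 2 + r ^ 2 ≠ 0 := by positivity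
    have h2 : 1 + ((y - v) / r) ^ 2 ≠ 0 := by positivity
    field_simp
    ring
  have hi : Integrable (fun u : ℝ => (1 + (u / r) ^ 2)⁻¹) :=
    integrable_inv_one_add_sq.comp_div hr.ne'
  constructor
  · rw [hfun]
    exact (hi.comp_sub_right v).const_mul _
  · rw [hfun, integral_const_mul, integral_sub_right_eq_self (fun u : ℝ => (1 + (u / r) ^ 2)⁻¹),
      Measure.integral_comp_div (fun u : ℝ => (1 + u ^ 2)⁻¹), integral_univ_inv_one_add_sq,
      abs_of_pos hr, smul_eq_mul]
    field_simp

lemma hardyInner_tmSystem_self {a : ℕ → ℍ[ℝ]} (ha : ∀ k, 1 ≤ k → a k ∈ rightHalf) (n : ℕ) :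
    hardyInner (tmSystem a (n + 1)) (tmSystem a (n + 1)) = 1 := by
  have hn := ha (n + 1) (Nat.le_add_left 1 n)
  have hr : 0 < (a (n + 1)).re := hn
  obtain ⟨hol, dom⟩ := tmStem_isHolomorphic_isDominatedBy ha n
  rw [(isInducedBy_tmSystem a n).hardyInner_eq (isInducedBy_tmSystem a n) hol hol dom dom]
  have hpt : ∀ y : ℝ, rePart (adj (tmStem a n ⟨0, y⟩) * tmStem a n ⟨0, y⟩) =
      ((a (n + 1)).re / π) • rePart (adj (kernelStem (a (n + 1)) ⟨0, y⟩) *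
        kernelStem (a (n + 1)) ⟨0, y⟩) := by
    intro y
    -- `C_a` is unitary on the axis, so only the kernels remain.
    have hs : √((a (n + 1)).re / π) * √((a (n + 1)).re / π) = (a (n + 1)).re / π :=
      mul_self_sqrt (by positivity)
    have hu := adj_productStem_mul_self ha n y
    rw [tmStem, adj_mul, mul_assoc, ← mul_assoc (adj (productStem a n _)), hu, one_mul, szegoStem,
      adj_smul, Complex.conj_ofReal, smul_mul_eq, mul_smul_eq, smul_smul, ← Complex.ofReal_mul,
      hs]
    ext <;> simp
  simp only [hpt, rePart_adj_kernelStem_mul_self hn]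
  generalize √((a (n + 1)).imI ^ 2 + (a (n + 1)).imJ ^ 2 + (a (n + 1)).imK ^ 2) = v
  obtain ⟨i1, h1⟩ := integrable_inv_sq_add_sq_and_integral hr v
  obtain ⟨i2, h2⟩ := integrable_inv_sq_add_sq_and_integral hr (-v)
  simp only [sub_neg_eq_add] at i2 h2
  have hcoe : ∀ t : ℝ, (t : ℍ[ℝ]) = t • (1 : ℍ[ℝ]) := fun t => by
    ext <;> simp
  simp only [hcoe]
  rw [integral_smul, integral_smul_const, integral_const_mul, integral_add i1 i2, h1, h2, smul_smul]
  have : (a (n + 1)).re / π * (1 / 2 * (π / (a (n + 1)).re + π / (a (n + 1)).re)) = 1 := by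
    field_simp
    norm_num
  rw [this, one_smul]

lemma hardyInner_tmSystem_of_lt {a : ℕ → ℍ[ℝ]} (ha : ∀ k, 1 ≤ k → a k ∈ rightHalf) (n m : ℕ) :
    hardyInner (tmSystem a (n + 1 + m + 1)) (tmSystem a (n + 1)) = 0 := by
  have hn := ha (n + 1) (Nat.le_add_left 1 n)
  obtain ⟨holn, domn⟩ := tmStem_isHolomorphic_isDominatedBy ha n
  obtain ⟨holl, doml⟩ := tmStem_isHolomorphic_isDominatedBy ha (n + 1 + m)
  rw [(isInducedBy_tmSystem a (n + 1 + m)).hardyInner_eq (isInducedBy_tmSystem a n) holl holn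
    doml domn]
  simp only [adj_tmStem_mul_tmStem ha]
  obtain ⟨hol, dom⟩ := tmStem_isHolomorphic_isDominatedBy (a := fun j => a (n + 1 + j))
    (fun k hk => ha _ (hk.trans (Nat.le_add_left k _))) m
  set c : ℂ := ((-√((a (n + 1)).re / π) : ℝ) : ℂ)
  have domc : IsDominatedBy (fun z => c • kernelStem (a (n + 1)) z) fun z => ‖z + 1‖⁻¹ := by
    obtain ⟨K, hK⟩ := isDominatedBy_kernelStem hn
    refine ⟨‖c‖ * K, fun z hz => ?_⟩
    rw [coordNorm_smul, mul_assoc]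
    exact mul_le_mul_of_nonneg_left (hK z hz) (norm_nonneg _)
  exact (((isHolomorphic_kernelStem hn).smul fun _ _ => differentiableAt_const c).mul
    hol).integral_rePart_eq_zero (domc.mul dom)

lemma hardyInner_star (f g : ℍ[ℝ] → ℍ[ℝ]) : star (hardyInner f g) = hardyInner g f := by
  have : StarModule ℝ ℍ[ℝ] := ⟨fun r q => Quaternion.star_smul r q⟩
  have h := (starL' ℝ : ℍ[ℝ] ≃L[ℝ] ℍ[ℝ]).integral_comp_comm (μ := boundaryMeasure)
    (fun p => star (boundaryValue g p) * boundaryValue f p)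
  simp only [starL'_apply, star_mul, star_star] at h
  rw [hardyInner, hardyInner, Quaternion.star_smul, h]

end SliceHardy
end

theorem mainTheorem7 (a : ℕ → ℍ[ℝ]) (ha : ∀ k, 1 ≤ k → a k ∈ SliceHardy.rightHalf) :
    (∀ k, 1 ≤ k → SliceHardy.MemHardy (SliceHardy.tmSystem a k)) ∧
    (∀ k, 1 ≤ k →
      SliceHardy.hardyInner (SliceHardy.tmSystem a k) (SliceHardy.tmSystem a k) = 1) ∧
    (∀ k l, 1 ≤ k → 1 ≤ l → k ≠ l →
      SliceHardy.hardyInner (SliceHardy.tmSystem a k) (SliceHardy.tmSystem a l) = 0) := by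
  have hlt : ∀ k l, 1 ≤ k → k < l →
      SliceHardy.hardyInner (SliceHardy.tmSystem a l) (SliceHardy.tmSystem a k) = 0 := by
    intro k l hk hkl
    obtain ⟨n, rfl⟩ := Nat.exists_eq_add_of_le' hk
    obtain ⟨m, rfl⟩ := Nat.exists_eq_add_of_lt hkl
    exact SliceHardy.hardyInner_tmSystem_of_lt ha n m
  refine ⟨fun k hk => ?_, fun k hk => ?_, fun k l hk hl hkl => ?_⟩
  · obtain ⟨n, rfl⟩ := Nat.exists_eq_add_of_le' hk
    obtain ⟨hol, dom⟩ := SliceHardy.tmStem_isHolomorphic_isDominatedBy ha n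
    exact (SliceHardy.isInducedBy_tmSystem a n).memHardy hol dom
  · obtain ⟨n, rfl⟩ := Nat.exists_eq_add_of_le' hk
    exact SliceHardy.hardyInner_tmSystem_self ha n
  · rcases lt_or_gt_of_ne hkl with h | h
    · rw [← SliceHardy.hardyInner_star, hlt k l hk h, star_zero]
    · exact hlt l k hl h
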